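/- \textbf{Theorem.} Here $\mathbb{N}=\{1,2,3,\dots\}$. Let $d\in\mathbb{N}$, $\alpha\in(0,\infty)$, $\theta\ge 0$ and $\kappa\in\mathbb{R}$. Let $c:\mathbb{N}\to\mathbb{N}\cup\{\infty\}$ be non-decreasing with $c(n)\asymp n^{\theta}(\log(2n))^{\kappa}$, i.e. there are constants $a,b>0$ with $a\,n^\theta(\log 2n)^\kappa\le c(n)\le b\,n^\theta(\log 2n)^\kappa$ for all $n\in\mathbb{N}$. Let $\ell:\mathbb{N}\to\mathbb{N}_{\ge 5}\cup\{\infty\}$ be non-decreasing with $\ell^*:=\sup_{n}\ell(n)<\infty$. \emph{Networks.} A neural network $\Phi=((A_1,b_1),\dots,(A_L,b_L))$ with $L\geq 1$ layers and dimensions $N_0,\dots,N_L\in\mathbb{N}$ consists of $A_j\in\mathbb{R}^{N_j\times N_{j-1}}$ and $b_j\in\mathbb{R}^{N_j}$. With $T_jx=A_jx+b_j$ and $\varrho_2(x)=\max(0,x)^2$ (ReQU, acting componentwise), its realization is $R\Phi=T_L\circ(\varrho_2\circ T_{L-1})\circ\dots\circ(\varrho_2\circ T_1)$. Let $\Sigma_n$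 be the set of all $R\Phi$ with $N_0=d$, $N_L=1$, at most $n$ nonzero entries in total in the $A_j,b_j$, at most $\ell(n)$ layers, and all entries of absolute value at most $c(n)$. \emph{Approximation space.} For measurable $u:[0,1]^d\to\mathbb{R}$ let $$\Gamma(u)=\max\Big\{\|u\|_{L^\infty([0,1]^d)},\ \sup_{n\in\mathbb{N}} n^{\alpha}\inf_{g\in\Sigma_n}\|u-g\|_{L^\infty([0,1]^d)}\Big\},\qquad \|u\|_{A}=\inf\{s>0:\Gamma(u/s)\le 1\}.$$ Let $A^{\alpha,\infty}_{\ell,c,\varrho_2}([0,1]^d)$ be the set of all $u\in L^\infty([0,1]^d)$ with $\|u\|_A<\infty$, identified with their continuous representatives, let $U=\{u:\|u\|_A\le 1\}\subset C([0,1]^d)$ be its unit ball, and let $\iota_\infty:U\to C([0,1]^d)$ be the embedding, where $Y:=C([0,1]^d)$ carries the uniform norm. \emph{Sampling orders.} For $m\in\mathbb{N}$ let $\mathrm{Alg}_m$ be the set of all maps $A:U\to Y$ of the form $A(u)=Q(u(x_1),\dots,u(x_m))$ with $x_1,\dots,x_m\in[0,1]^d$ and $Q:\mathbb{R}^m\to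 Y$, and put $$e^{\mathrm{det}}_m=\inf_{A\in\mathrm{Alg}_m}\ \sup_{u\in U}\|A(u)-\iota_\infty(u)\|_Y .$$ A Monte Carlo method using $m$ samples is a family $(A_\omega)_{\omega\in\Omega}$ of maps $U\to Y$ over a probability space $\Omega$, together with a measurable $\boldsymbol m:\Omega\to\mathbb{N}$ with $\mathbb{E}[\boldsymbol m]\le m$, such that $\omega\mapsto A_\omega(u)$ is Borel measurable for each $u\in U$ and $A_\omega\in\mathrm{Alg}_{\boldsymbol m(\omega)}$ for each $\omega$. Let $e^{\mathrm{MC}}_m$ be the infimum over these methods of $\sup_{u\in U}\mathbb{E}_\omega\|\iota_\infty(u)-A_\omega(u)\|_Y$. For $\star\in\{\mathrm{det},\mathrm{MC}\}$ set $$err^{\star}(U,\iota_\infty)=\sup\big\{\beta\ge 0:\ \exists\, C>0\ \forall m\in\mathbb{N}:\ e^{\star}_m\le C\,m^{-\beta}\big\}.$$ Then, for both $err=err^{\mathrm{det}}$ and $err=err^{\mathrm{MC}}$, $$\frac1d\cdot\frac{\alpha}{\alpha+(2^{\ell^*}-1)(\theta+\frac12)}\ \le\ err(U,\iota_\infty)\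 \le\ \frac{64}{d}\cdot\frac{\alpha}{8\alpha+(2^{\ell^*}-1)(\theta+\frac12)} .$$ -/

import Mathlib

open MeasureTheory
open scoped ENNReal NNReal

universe u

noncomputable section

namespace ReQUApprox

/-- A neural network with input dimension `k` and output dimension `r`: a nonempty list of
matrix-vector tuples `(A₁, b₁), …, (A_L, b_L)` with matching, positive dimensions.
`last A b` is a network with a single layer, and `cons A b Φ` puts `(A, b)` in front of `Φ`. -/
inductive Network : ℕ → ℕ → Type
  | last {k r : ℕ} (hk : 0 < k) (hr : 0 < r)
      (A : Matrix (Fin r) (Fin k) ℝ) (b : Fin r → ℝ) : Network k r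
  | cons {k m r : ℕ} (hk : 0 < k)
      (A : Matrix (Fin m) (Fin k) ℝ) (b : Fin m → ℝ) (Φ : Network m r) : Network k r

/-- The number of nonzero entries of a matrix and of a vector, added up. -/
def numNonzero {k m : ℕ} (A : Matrix (Fin m) (Fin k) ℝ) (b : Fin m → ℝ) : ℕ :=
  (∑ i, hammingNorm (fun j => A i j)) + hammingNorm b

/-- The largest absolute value of an entry of a matrix or of a vector. -/
def maxEntry {k m : ℕ} (A : Matrix (Fin m) (Fin k) ℝ) (b : Fin m → ℝ) : ℝ≥0 :=
  max (Finset.univ.sup fun i => Finset.univ.sup fun j => ‖A i j‖₊)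
    (Finset.univ.sup fun i => ‖b i‖₊)

namespace Network

/-- The number of layers `L(Φ)`. -/
def numLayers : {k r : ℕ} → Network k r → ℕ
  | _, _, last _ _ _ _ => 1
  | _, _, cons _ _ _ Φ => 1 + Φ.numLayers

/-- The number of nonzero weights `W(Φ)`. -/
def numWeights : {k r : ℕ} → Network k r → ℕ
  | _, _, last _ _ A b => numNonzero A b
  | _, _, cons _ A b Φ => numNonzero A b + Φ.numWeights

/-- The largest magnitude `‖Φ‖_NN` of a weight. -/
def maxWeight : {k r : ℕ} → Network k r → ℝ≥0
  | _, _, last _ _ A b => maxEntry A b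
  | _, _, cons _ A b Φ => max (maxEntry A b) Φ.maxWeight

/-- The realization `T_L ∘ (ρ ∘ T_{L-1}) ∘ ⋯ ∘ (ρ ∘ T₁)` with `T_j x = A_j x + b_j`, where the
activation function `ρ` acts componentwise. -/
def realize (ρ : ℝ → ℝ) : {k r : ℕ} → Network k r → (Fin k → ℝ) → (Fin r → ℝ)
  | _, _, last _ _ A b => fun x => A.mulVec x + b
  | _, _, cons _ A b Φ => fun x => Φ.realize ρ (fun i => ρ ((A.mulVec x + b) i))

end Network

/-- The rectified quadratic unit. -/
def requ (x : ℝ) : ℝ := (max 0 x) ^ 2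

/-- The unit cube `[0,1]^d`. -/
abbrev Cube (d : ℕ) : Set (Fin d → ℝ) := Set.Icc 0 1

/-- Lebesgue measure on the unit cube. -/
def cubeVolume (d : ℕ) : Measure (Cube d) := (volume : Measure (Fin d → ℝ)).comap Subtype.val

/-- The set `Σ_n` of realizations of ReQU networks with input dimension `d`, output dimension `1`,
at most `n` nonzero weights, at most `ℓ n` layers and weights of magnitude at most `c n`. -/
def networkClass (d : ℕ) (ℓ c : ℕ+ → ℕ∞) (n : ℕ+) : Set ((Fin d → ℝ) → ℝ) :=
  {g | ∃ Φ : Network d 1,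
    Φ.numWeights ≤ (n : ℕ) ∧
    (Φ.numLayers : ℕ∞) ≤ ℓ n ∧
    (Φ.maxWeight : ℝ≥0∞) ≤ (c n : ℝ≥0∞) ∧
    g = fun x => Φ.realize requ x 0}

/-- The `L^p([0,1]^d)` distance of `v` to a set `G` of functions. -/
def lpDist {d : ℕ} (p : ℝ≥0∞) (v : Cube d → ℝ) (G : Set ((Fin d → ℝ) → ℝ)) : ℝ≥0∞ :=
  ⨅ g ∈ G, eLpNorm (fun x : Cube d => v x - g x) p (cubeVolume d)

/-- The functional `Γ_{α,p}`. -/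
def gammaFun {d : ℕ} (ℓ c : ℕ+ → ℕ∞) (α : ℝ) (p : ℝ≥0∞) (v : Cube d → ℝ) : ℝ≥0∞ :=
  max (eLpNorm v p (cubeVolume d))
    (⨆ n : ℕ+, ENNReal.ofReal (((n : ℕ) : ℝ) ^ α) * lpDist p v (networkClass d ℓ c n))

/-- The quasi-norm of the approximation space `A^{α,p}([0,1]^d)`. -/
def approxNorm {d : ℕ} (ℓ c : ℕ+ → ℕ∞) (α : ℝ) (p : ℝ≥0∞) (v : Cube d → ℝ) : ℝ≥0∞ :=
  sInf {t | ∃ s : ℝ, 0 < s ∧ gammaFun ℓ c α p (fun x => v x / s) ≤ 1 ∧ t = ENNReal.ofReal s}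

/-- The unit ball of `A^{α,∞}([0,1]^d)`, as a set of continuous functions: elements of this space
are identified with their continuous representatives. -/
def unitBall (d : ℕ) (ℓ c : ℕ+ → ℕ∞) (α : ℝ) : Set C(Cube d, ℝ) :=
  {v | MemLp v ∞ (cubeVolume d) ∧ approxNorm ℓ c α ∞ v ≤ 1}

section SamplingComplexity

variable {d : ℕ} {Y : Type} [NormedAddCommGroup Y]

/-- Deterministic methods that use `m` point samples. -/
def Alg (m : ℕ+) (U : Set C(Cube d, ℝ)) (Y : Type) : Set (U → Y) :=
  {A | ∃ (x : Fin m → Cube d) (Q : (Fin m → ℝ) → Y),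
    ∀ v : U, A v = Q fun i => (v : C(Cube d, ℝ)) (x i)}

/-- The optimal error of deterministic methods that use `m` point samples. -/
def detError (m : ℕ+) (U : Set C(Cube d, ℝ)) (S : U → Y) : ℝ≥0∞ :=
  ⨅ A ∈ Alg m U Y, ⨆ v : U, ‖A v - S v‖ₑ

/-- `(A, N)` is a Monte Carlo method, on the probability space `(Ω, P)`, that uses at most `m`
point samples on average. -/
structure IsMonteCarlo (m : ℕ+) (U : Set C(Cube d, ℝ)) {Ω : Type u} [MeasurableSpace Ω]
    (P : Measure Ω) (A : Ω → U → Y) (N : Ω → ℕ+) : Prop where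
  measurable_count : Measurable fun ω => (N ω : ℕ)
  mean_count : ∫⁻ ω, ((N ω : ℕ) : ℝ≥0∞) ∂P ≤ ((m : ℕ) : ℝ≥0∞)
  measurable_method : ∀ v : U, Measurable[_, borel Y] fun ω => A ω v
  mem_alg : ∀ ω, A ω ∈ Alg (N ω) U Y

/-- The optimal error of Monte Carlo methods that use `m` point samples. -/
def mcError (m : ℕ+) (U : Set C(Cube d, ℝ)) (S : U → Y) : ℝ≥0∞ :=
  sInf {e | ∃ (Ω : Type u) (_ : MeasurableSpace Ω) (P : Measure Ω) (A : Ω → U → Y) (N : Ω → ℕ+),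
    IsProbabilityMeasure P ∧ IsMonteCarlo m U P A N ∧ e = ⨆ v : U, ∫⁻ ω, ‖S v - A ω v‖ₑ ∂P}

/-- The optimal order of a sequence of errors: the supremum of all `β ≥ 0` such that
`e m ≤ C * m ^ (-β)` for some `C > 0` and all `m`. -/
def optimalOrder (e : ℕ+ → ℝ≥0∞) : ℝ≥0∞ :=
  sSup {b | ∃ β : ℝ, 0 ≤ β ∧ b = ENNReal.ofReal β ∧
    ∃ C : ℝ, 0 < C ∧ ∀ m : ℕ+, e m ≤ ENNReal.ofReal (C * ((m : ℕ) : ℝ) ^ (-β))}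

/-- The optimal order for approximating `S` by deterministic methods. -/
def errDet (U : Set C(Cube d, ℝ)) (S : U → Y) : ℝ≥0∞ :=
  optimalOrder fun m => detError m U S

/-- The optimal order for approximating `S` by Monte Carlo methods. -/
def errMC (U : Set C(Cube d, ℝ)) (S : U → Y) : ℝ≥0∞ :=
  optimalOrder fun m => mcError.{u} m U S

end SamplingComplexity

/-- The embedding of a set `U` of continuous functions into `C([0,1]^d)`, with the uniform norm. -/
def iotaInf {d : ℕ} (U : Set C(Cube d, ℝ)) : U → C(Cube d, ℝ) := fun v => v

/-- The maximal depth `ℓ* = sup_n ℓ(n)`. -/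
def maxDepth (ℓ : ℕ+ → ℕ∞) : ℕ∞ := ⨆ n, ℓ n

/-- `c(n) ≍ n^θ (log (2n))^κ`. -/
def HasGrowth (c : ℕ+ → ℕ∞) (θ κ : ℝ) : Prop :=
  ∃ a b : ℝ, 0 < a ∧ 0 < b ∧ ∀ n : ℕ+,
    ENNReal.ofReal (a * (((n : ℕ) : ℝ) ^ θ * Real.log (2 * ((n : ℕ) : ℝ)) ^ κ)) ≤ (c n : ℝ≥0∞) ∧
    (c n : ℝ≥0∞) ≤ ENNReal.ofReal (b * (((n : ℕ) : ℝ) ^ θ * Real.log (2 * ((n : ℕ) : ℝ)) ^ κ))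

end ReQUApprox

end

noncomputable section

namespace ReQUApprox

/-! ### Growth of the weight bound -/

/-! Both bounds measure how steep a ReQU network can be for a weight budget n. Write L = ℓ* and γ =
(2^L - 1)(θ + 1/2). Squaring doubles exponents at each layer, and the first layer sees only d
inputs, so on the cube L layers with weights at most C have Lipschitz constant of order
n^(2^(L-1)-1) C^(2^L-1). The exponent of n lies exactly 1/2 below (2^L - 1)/2, and this spare
n^(1/2) absorbs the logarithms in c(n): the Lipschitz constant is O(n^γ)
(`exists_lipschitz_networkClass`).

Lower bound on the order: an element of the unit ball is O(n^(-α))-close to a bounded multiple of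
such a network, so for every n it oscillates by O(n^(-α) + n^γ h) at distance h. With h ≈ m^(-1/d)
and n ≈ h^(-1/(α+γ)), values on a grid of at most m points determine it up to O(m^(-α/(d(α+γ))))
(`exists_detError_le`). A deterministic method is a Monte Carlo method, so the bound transfers.

Upper bound on the order: a network with about N^2 weights can compute a bump of radius w and height
up to N^(2^(L-3)-1) C^(2^(L-2)-1) w^4 (`Network.exists_localized`). A network function in the class
for n with sup norm at most n^(-α) lies in the unit ball, so the ball contains about n^(dμ) bumps of
height n^(-α) with disjoint supports, where μ = (8α+γ)/64. A method with far fewer samples misses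
most of them and cannot tell them from 0 (`le_mcError`). Comparing n^(-α) with m ≈ n^(dμ) bounds the
order by α/(dμ). -/

theorem log_rpow_le_mul_rpow (κ : ℝ) {ε : ℝ} (hε : 0 < ε) :
    ∃ K : ℝ, 0 < K ∧ ∀ n : ℕ+,
      Real.log (2 * ((n : ℕ) : ℝ)) ^ κ ≤ K * ((n : ℕ) : ℝ) ^ ε := by
  have hone : ∀ n : ℕ+, (1 : ℝ) ≤ ((n : ℕ) : ℝ) := fun n => by exact_mod_cast n.pos
  rcases lt_or_ge 0 κ with hκ | hκ
  · have hδ : 0 < ε / κ := by positivity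
    refine ⟨(2 ^ (ε / κ) / (ε / κ)) ^ κ, by positivity, fun n => ?_⟩
    have h1 := hone n
    have hlog : 0 ≤ Real.log (2 * ((n : ℕ) : ℝ)) := Real.log_nonneg (by linarith)
    calc Real.log (2 * ((n : ℕ) : ℝ)) ^ κ
        ≤ ((2 * ((n : ℕ) : ℝ)) ^ (ε / κ) / (ε / κ)) ^ κ :=
          Real.rpow_le_rpow hlog (Real.log_le_rpow_div (by linarith) hδ) hκ.le
      _ = (2 ^ (ε / κ) / (ε / κ) * ((n : ℕ) : ℝ) ^ (ε / κ)) ^ κ := by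
          rw [Real.mul_rpow (by norm_num) (by linarith)]; ring_nf
      _ = _ := by
          rw [Real.mul_rpow (by positivity) (by positivity), ← Real.rpow_mul (by linarith),
            div_mul_cancel₀ _ hκ.ne']
  · have hlog2 : 0 < Real.log 2 := Real.log_pos (by norm_num)
    refine ⟨Real.log 2 ^ κ, by positivity, fun n => ?_⟩
    have h1 := hone n
    calc Real.log (2 * ((n : ℕ) : ℝ)) ^ κ ≤ Real.log 2 ^ κ :=
          Real.rpow_le_rpow_of_nonpos hlog2 (Real.log_le_log (by norm_num) (by linarith)) hκ
      _ ≤ _ := le_mul_of_one_le_right (by positivity) (Real.one_le_rpow h1 hε.le)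

section Growth

variable {c : ℕ+ → ℕ∞} {θ κ : ℝ}

/-- The upper growth bound is finite, which excludes ∞; the lower one is positive, which forces the
integer to be at least 1. Hence the entries ±1 are always admissible in a network. -/
theorem HasGrowth.exists_nat (hc : HasGrowth c θ κ) :
    ∃ C : ℕ+ → ℕ, (∀ n, c n = C n) ∧ (∀ n, 1 ≤ C n) ∧
      ∃ a b : ℝ, 0 < a ∧ 0 < b ∧ ∀ n : ℕ+,
        a * (((n : ℕ) : ℝ) ^ θ * Real.log (2 * ((n : ℕ) : ℝ)) ^ κ) ≤ C n ∧
        (C n : ℝ) ≤ b * (((n : ℕ) : ℝ) ^ θ * Real.log (2 * ((n : ℕ) : ℝ)) ^ κ) := by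
  obtain ⟨a, b, ha, hb, h⟩ := hc
  have hlog : ∀ n : ℕ+, 0 < Real.log (2 * ((n : ℕ) : ℝ)) := fun n => by
    have : (1 : ℝ) ≤ ((n : ℕ) : ℝ) := by exact_mod_cast n.pos
    exact Real.log_pos (by linarith)
  have hpos : ∀ n : ℕ+, 0 < ((n : ℕ) : ℝ) ^ θ * Real.log (2 * ((n : ℕ) : ℝ)) ^ κ := fun n => by
    have := hlog n
    positivity
  have htop : ∀ n, c n ≠ ⊤ := fun n hn => by
    have := (h n).2
    rw [hn] at this
    simp at this
  have hC : ∀ n, c n = ((c n).toNat : ℕ∞) := fun n => (ENat.natCast_toNat (htop n)).symm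
  have hle : ∀ n : ℕ+, a * (((n : ℕ) : ℝ) ^ θ * Real.log (2 * ((n : ℕ) : ℝ)) ^ κ) ≤ (c n).toNat ∧
      ((c n).toNat : ℝ) ≤ b * (((n : ℕ) : ℝ) ^ θ * Real.log (2 * ((n : ℕ) : ℝ)) ^ κ) := fun n => by
    have := h n
    rw [hC n] at this
    simp only [ENat.toENNReal_coe] at this
    rw [← ENNReal.ofReal_natCast, ENNReal.ofReal_le_ofReal_iff (by positivity),
      ENNReal.ofReal_le_ofReal_iff (mul_nonneg hb.le (hpos n).le)] at this
    exact this
  refine ⟨fun n => (c n).toNat, hC, fun n => ?_, a, b, ha, hb, hle⟩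
  have := (mul_pos ha (hpos n)).trans_le (hle n).1
  exact_mod_cast this

theorem le_mul_rpow_of_growth {C : ℕ+ → ℕ} {b ε : ℝ} (hb : 0 < b) (hε : 0 < ε)
    (h : ∀ n : ℕ+, (C n : ℝ) ≤ b * (((n : ℕ) : ℝ) ^ θ * Real.log (2 * ((n : ℕ) : ℝ)) ^ κ)) :
    ∃ K : ℝ, 0 < K ∧ ∀ n : ℕ+, (C n : ℝ) ≤ K * ((n : ℕ) : ℝ) ^ (θ + ε) := by
  obtain ⟨K, hK, hlog⟩ := log_rpow_le_mul_rpow κ hε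
  refine ⟨b * K, by positivity, fun n => (h n).trans ?_⟩
  have hn : (0 : ℝ) < ((n : ℕ) : ℝ) := by exact_mod_cast n.pos
  rw [Real.rpow_add hn, mul_assoc]
  refine mul_le_mul_of_nonneg_left ?_ hb.le
  calc _ ≤ ((n : ℕ) : ℝ) ^ θ * (K * ((n : ℕ) : ℝ) ^ ε) := by gcongr; exact hlog n
    _ = _ := by ring

theorem mul_rpow_le_of_growth {C : ℕ+ → ℕ} {a ε : ℝ} (ha : 0 < a) (hε : 0 < ε)
    (h : ∀ n : ℕ+, a * (((n : ℕ) : ℝ) ^ θ * Real.log (2 * ((n : ℕ) : ℝ)) ^ κ) ≤ C n) :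
    ∃ K : ℝ, 0 < K ∧ ∀ n : ℕ+, K * ((n : ℕ) : ℝ) ^ (θ - ε) ≤ (C n : ℝ) := by
  -- A lower bound for log^κ is an upper bound for log^(-κ).
  obtain ⟨K, hK, hlog⟩ := log_rpow_le_mul_rpow (-κ) hε
  refine ⟨a / K, by positivity, fun n => le_trans ?_ (h n)⟩
  have hn : (0 : ℝ) < ((n : ℕ) : ℝ) := by exact_mod_cast n.pos
  have h1 : (1 : ℝ) ≤ ((n : ℕ) : ℝ) := by exact_mod_cast n.pos
  have hl : 0 < Real.log (2 * ((n : ℕ) : ℝ)) := Real.log_pos (by linarith)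
  have := hlog n
  rw [Real.rpow_neg hl.le, inv_le_iff_one_le_mul₀ (by positivity)] at this
  rw [Real.rpow_sub hn, div_mul_div_comm, div_le_iff₀ (by positivity)]
  calc a * ((n : ℕ) : ℝ) ^ θ ≤ a * ((n : ℕ) : ℝ) ^ θ *
        (Real.log (2 * ((n : ℕ) : ℝ)) ^ κ * (K * ((n : ℕ) : ℝ) ^ ε)) :=
        le_mul_of_one_le_right (by positivity) (by linarith)
    _ = _ := by ring

end Growth

/-! ### Lipschitz bounds for ReQU networks -/

theorem requ_nonneg (x : ℝ) : 0 ≤ requ x := sq_nonneg _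

theorem requ_of_nonneg {x : ℝ} (hx : 0 ≤ x) : requ x = x ^ 2 := by simp [requ, hx]

theorem requ_of_nonpos {x : ℝ} (hx : x ≤ 0) : requ x = 0 := by simp [requ, hx]

theorem requ_le {x M : ℝ} (hx : |x| ≤ M) : requ x ≤ M ^ 2 := by
  have h0 : 0 ≤ M := (abs_nonneg x).trans hx
  exact pow_le_pow_left₀ (le_max_left _ _) (max_le h0 ((le_abs_self x).trans hx)) 2

theorem abs_requ_sub_le {x y M : ℝ} (hx : |x| ≤ M) (hy : |y| ≤ M) :
    |requ x - requ y| ≤ 2 * M * |x - y| := by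
  have h0 : 0 ≤ M := (abs_nonneg x).trans hx
  have hx' : max 0 x ≤ M := max_le h0 ((le_abs_self x).trans hx)
  have hy' : max 0 y ≤ M := max_le h0 ((le_abs_self y).trans hy)
  have e : requ x - requ y = (max 0 x + max 0 y) * (max 0 x - max 0 y) := by
    simp only [requ]; ring
  have hd : |max 0 x - max 0 y| ≤ |x - y| := by
    have := abs_max_sub_max_le_max 0 x 0 y
    simpa using this
  have hs : 0 ≤ max 0 x + max 0 y := add_nonneg (le_max_left _ _) (le_max_left _ _)
  rw [e, abs_mul, abs_of_nonneg hs]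
  exact mul_le_mul (by linarith) hd (abs_nonneg _) (by linarith)

theorem continuous_requ : Continuous requ := by unfold requ; fun_prop

namespace Network

theorem continuous_realize {k r : ℕ} (Φ : Network k r) : Continuous (Φ.realize requ) := by
  induction Φ with
  | last hk hr A b =>
    simp only [realize]
    fun_prop
  | cons hk A b Φ ih =>
    simp only [realize]
    refine ih.comp (continuous_pi fun i => continuous_requ.comp ?_)
    fun_prop

end Network

section Layer

variable {k m : ℕ} {A : Matrix (Fin m) (Fin k) ℝ} {b : Fin m → ℝ} {C : ℝ≥0}

theorem maxEntry_le_iff :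
    maxEntry A b ≤ C ↔ (∀ i j, |A i j| ≤ C) ∧ ∀ i, |b i| ≤ C := by
  simp only [maxEntry, max_le_iff, Finset.sup_le_iff, Finset.mem_univ, true_imp_iff,
    ← NNReal.coe_le_coe, coe_nnnorm, Real.norm_eq_abs]

theorem numNonzero_le (A : Matrix (Fin m) (Fin k) ℝ) (b : Fin m → ℝ) :
    numNonzero A b ≤ m * k + m := by
  unfold numNonzero
  refine add_le_add ?_ (hammingNorm_le_card_fintype.trans (by simp))
  calc _ ≤ ∑ _i : Fin m, k :=
        Finset.sum_le_sum fun i _ => hammingNorm_le_card_fintype.trans (by simp)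
    _ = _ := by simp

theorem abs_sum_mul_le (a x : Fin k → ℝ) {D C : ℝ} (ha : ∀ j, |a j| ≤ C) (hx : ∀ j, |x j| ≤ D) :
    |∑ j, a j * x j| ≤ hammingNorm a * (C * D) := by
  calc |∑ j, a j * x j| ≤ ∑ j, |a j * x j| := Finset.abs_sum_le_sum_abs _ _
    _ ≤ ∑ j, if a j ≠ 0 then C * D else 0 := by
        refine Finset.sum_le_sum fun j _ => ?_
        split_ifs with h
        · rw [abs_mul]
          exact mul_le_mul (ha j) (hx j) (abs_nonneg _) ((abs_nonneg _).trans (ha j))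
        · simp only [ne_eq, not_not] at h
          simp [h]
    _ = _ := by rw [← Finset.sum_filter, Finset.sum_const, nsmul_eq_mul]; rfl

theorem hammingNorm_row_le (A : Matrix (Fin m) (Fin k) ℝ) (i : Fin m) :
    hammingNorm (fun j => A i j) ≤ ∑ i, hammingNorm (fun j => A i j) :=
  Finset.single_le_sum (f := fun i => hammingNorm (fun j => A i j)) (fun _ _ => Nat.zero_le _)
    (Finset.mem_univ i)

/-- Since B ≥ 1, a nonzero bias costs no more than one further input of size B, so row and bias are
counted together by n. -/
theorem abs_affine_le {n : ℕ} (hA : numNonzero A b ≤ n) (hC : maxEntry A b ≤ C)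
    {x : Fin k → ℝ} {B : ℝ} (hB : 1 ≤ B) (hx : ∀ j, |x j| ≤ B) (i : Fin m) :
    |(A.mulVec x + b) i| ≤ n * C * B := by
  obtain ⟨h1, h2⟩ := maxEntry_le_iff.1 hC
  have hb : |b i| ≤ hammingNorm b * ((C : ℝ) * B) := by
    by_cases h : b i = 0
    · rw [h, abs_zero]; positivity
    · have : (1 : ℝ) ≤ hammingNorm b := by
        exact_mod_cast hammingNorm_pos_iff.2 fun h' => h (congrFun h' i)
      calc |b i| ≤ C := h2 i
        _ ≤ C * B := le_mul_of_one_le_right C.2 hB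
        _ ≤ _ := le_mul_of_one_le_left (by positivity) this
  have hs := abs_sum_mul_le (fun j => A i j) x (h1 i) hx
  have hn : ((hammingNorm fun j => A i j : ℕ) : ℝ) + hammingNorm b ≤ n := by
    exact_mod_cast (Nat.add_le_add_right (hammingNorm_row_le A i) _).trans hA
  calc |(A.mulVec x + b) i| ≤ |∑ j, A i j * x j| + |b i| := abs_add_le _ _
    _ ≤ ((hammingNorm fun j => A i j : ℕ) + hammingNorm b) * ((C : ℝ) * B) := by linarith
    _ ≤ n * ((C : ℝ) * B) := by gcongr
    _ = _ := by ring

theorem abs_affine_sub_le {n : ℕ} (hA : ∀ i, hammingNorm (fun j => A i j) ≤ n)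
    (hC : maxEntry A b ≤ C) {x y : Fin k → ℝ} {D : ℝ} (hD : 0 ≤ D)
    (hx : ∀ j, |x j - y j| ≤ D) (i : Fin m) :
    |(A.mulVec x + b) i - (A.mulVec y + b) i| ≤ n * C * D := by
  have hs := abs_sum_mul_le (fun j => A i j) (fun j => x j - y j) ((maxEntry_le_iff.1 hC).1 i) hx
  have e : (A.mulVec x + b) i - (A.mulVec y + b) i = ∑ j, A i j * (x j - y j) := by
    simp [Matrix.mulVec, dotProduct, mul_sub]
  rw [e]
  calc _ ≤ _ := hs
    _ ≤ (n : ℝ) * (C * D) := by gcongr; exact hA i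
    _ = _ := by ring

end Layer

namespace Network

theorem numLayers_pos {k r : ℕ} (Φ : Network k r) : 1 ≤ Φ.numLayers := by
  cases Φ <;> simp [numLayers]

/-- A hidden layer turns the size and distance bounds (B, D) into ((nCB)^2, 2(nCB)(nCD)), and
iterating gives the exponents. As nC ≥ 1 and B ≥ 1, the bound increases with J, so shallower
networks are covered too. -/
theorem abs_realize_sub_le {k r : ℕ} (Φ : Network k r) {n : ℕ} {C : ℝ≥0}
    (hn : Φ.numWeights ≤ n) (hC : Φ.maxWeight ≤ C) (hnC : 1 ≤ (n : ℝ) * C) {J : ℕ}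
    (hJ : Φ.numLayers ≤ J + 1) {x y : Fin k → ℝ} {B D : ℝ} (hB : 1 ≤ B) (hD : 0 ≤ D)
    (hx : ∀ j, |x j| ≤ B) (hy : ∀ j, |y j| ≤ B) (hxy : ∀ j, |x j - y j| ≤ D) (i : Fin r) :
    |Φ.realize requ x i - Φ.realize requ y i| ≤
      2 ^ J * (n * C : ℝ) ^ (2 ^ (J + 1) - 1) * B ^ (2 ^ J - 1) * D := by
  induction Φ generalizing B D J with
  | last hk hr A b =>
    have h := abs_affine_sub_le (fun i => (hammingNorm_row_le A i).trans
      ((Nat.le_add_right _ _).trans hn)) hC hD hxy i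
    refine h.trans (mul_le_mul_of_nonneg_right ?_ hD)
    have h1 : (n * C : ℝ) ≤ (n * C : ℝ) ^ (2 ^ (J + 1) - 1) :=
      le_self_pow₀ hnC (by have := Nat.one_lt_two_pow (n := J + 1) (by omega); omega)
    have h2 : (1 : ℝ) ≤ B ^ (2 ^ J - 1) := one_le_pow₀ hB
    have h3 : (1 : ℝ) ≤ 2 ^ J := one_le_pow₀ (by norm_num)
    calc (n * C : ℝ) ≤ (n * C : ℝ) ^ (2 ^ (J + 1) - 1) := h1
      _ ≤ 2 ^ J * (n * C : ℝ) ^ (2 ^ (J + 1) - 1) := le_mul_of_one_le_left (by positivity) h3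
      _ ≤ _ := le_mul_of_one_le_right (by positivity) h2
  | cons hk A b Φ ih =>
    simp only [numLayers] at hJ
    simp only [numWeights] at hn
    simp only [maxWeight, max_le_iff] at hC
    obtain ⟨J, rfl⟩ : ∃ I, J = I + 1 := ⟨J - 1, by have := Φ.numLayers_pos; omega⟩
    have hzx := abs_affine_le ((Nat.le_add_right _ _).trans hn) hC.1 hB hx
    have hzy := abs_affine_le ((Nat.le_add_right _ _).trans hn) hC.1 hB hy
    have hz := abs_affine_sub_le (fun i => (hammingNorm_row_le A i).trans
      ((Nat.le_add_right _ _).trans ((Nat.le_add_right _ _).trans hn))) hC.1 hD hxy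
    have hB' : 1 ≤ n * C * B := by nlinarith
    have key := ih ((Nat.le_add_left _ _).trans hn) hC.2 (J := J) (by omega)
      (x := fun i => requ ((A.mulVec x + b) i)) (y := fun i => requ ((A.mulVec y + b) i))
      (B := (n * C * B) ^ 2) (D := 2 * (n * C * B) * (n * C * D)) (one_le_pow₀ hB')
      (by positivity)
      (fun j => by rw [abs_of_nonneg (requ_nonneg _)]; exact requ_le (hzx j))
      (fun j => by rw [abs_of_nonneg (requ_nonneg _)]; exact requ_le (hzy j))
      (fun j => (abs_requ_sub_le (hzx j) (hzy j)).trans (by gcongr; exact hz j)) i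
    refine key.trans (le_of_eq ?_)
    -- With 2^J = e + 1 all truncated exponents become linear in e.
    obtain ⟨e, he⟩ : ∃ e, 2 ^ J = e + 1 :=
      ⟨2 ^ J - 1, by have := Nat.one_le_two_pow (n := J); omega⟩
    have e1 : 2 ^ (J + 1) - 1 = 2 * e + 1 := by rw [pow_succ]; omega
    have e2 : 2 ^ (J + 1 + 1) - 1 = 4 * e + 3 := by rw [pow_succ, pow_succ]; omega
    have e3 : 2 ^ J - 1 = e := by omega
    rw [e1, e2, e3]
    ring

/-- On the unit cube, the first layer only contributes a factor that depends on the dimension. -/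
theorem abs_realize_sub_le_of_mem_cube {d r : ℕ} (Φ : Network d r) {n : ℕ} {C : ℝ≥0}
    (hn : Φ.numWeights ≤ n) (hC : Φ.maxWeight ≤ C) (hn1 : 1 ≤ n) (hC1 : 1 ≤ C) {J : ℕ}
    (hJ : Φ.numLayers ≤ J + 2) {x y : Fin d → ℝ} (hx : x ∈ Cube d) (hy : y ∈ Cube d)
    {D : ℝ} (hD : 0 ≤ D) (hxy : ∀ j, |x j - y j| ≤ D) (i : Fin r) :
    |Φ.realize requ x i - Φ.realize requ y i| ≤
      2 ^ (J + 1) * (d + 1 : ℝ) ^ (2 ^ (J + 1)) *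
        ((n : ℝ) ^ (2 ^ (J + 1) - 1) * (C : ℝ) ^ (2 ^ (J + 2) - 1)) * D := by
  have hn1' : (1 : ℝ) ≤ n := by exact_mod_cast hn1
  have hC1' : (1 : ℝ) ≤ C := by exact_mod_cast hC1
  have hd1 : (1 : ℝ) ≤ d + 1 := by linarith [d.cast_nonneg (α := ℝ)]
  have hcube : ∀ {z : Fin d → ℝ}, z ∈ Cube d → ∀ j, |z j| ≤ 1 := fun hz j => by
    rw [abs_of_nonneg (hz.1 j)]; exact hz.2 j
  have hrow : ∀ {m : ℕ} (A : Matrix (Fin m) (Fin d) ℝ) (i : Fin m),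
      hammingNorm (fun j => A i j) ≤ d := fun A i => hammingNorm_le_card_fintype.trans (by simp)
  cases Φ with
  | last hk hr A b =>
    refine (abs_affine_sub_le (hrow A) hC hD hxy i).trans (mul_le_mul_of_nonneg_right ?_ hD)
    have h1 : (C : ℝ) ≤ (C : ℝ) ^ (2 ^ (J + 2) - 1) :=
      le_self_pow₀ hC1' (by have := Nat.one_lt_two_pow (n := J + 2) (by omega); omega)
    have h2 : (1 : ℝ) ≤ (n : ℝ) ^ (2 ^ (J + 1) - 1) := one_le_pow₀ hn1'
    have h3 : (1 : ℝ) ≤ 2 ^ (J + 1) := one_le_pow₀ (by norm_num)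
    have h4 : (d + 1 : ℝ) ≤ (d + 1 : ℝ) ^ (2 ^ (J + 1)) := le_self_pow₀ hd1 (by positivity)
    refine mul_le_mul ?_ ?_ (by positivity) (by positivity)
    · calc (d : ℝ) ≤ (d + 1 : ℝ) ^ (2 ^ (J + 1)) := by linarith
        _ ≤ _ := le_mul_of_one_le_left (by positivity) h3
    · exact h1.trans (le_mul_of_one_le_left (by positivity) h2)
  | cons hk A b Φ =>
    simp only [numLayers] at hJ
    simp only [numWeights] at hn
    simp only [maxWeight, max_le_iff] at hC
    have hz1 : ∀ {z : Fin d → ℝ}, z ∈ Cube d → ∀ j, |(A.mulVec z + b) j| ≤ (d + 1) * C := by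
      intro z hz j
      have hA := maxEntry_le_iff.1 hC.1
      have h := abs_sum_mul_le (fun k => A j k) z (hA.1 j) (hcube hz)
      have h' : ((hammingNorm fun k => A j k : ℕ) : ℝ) ≤ d := by exact_mod_cast hrow A j
      calc |(A.mulVec z + b) j| ≤ |∑ k, A j k * z k| + |b j| := abs_add_le _ _
        _ ≤ (hammingNorm fun k => A j k : ℕ) * (C * 1) + C := add_le_add h (hA.2 j)
        _ ≤ d * (C * 1) + C := by gcongr
        _ = _ := by ring
    have hz := abs_affine_sub_le (hrow A) hC.1 hD hxy
    have hB' : 1 ≤ (d + 1) * (C : ℝ) := by nlinarith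
    -- The first layer has rows of length d and inputs in [0,1], so the remaining layers start from
    -- sizes free of n.
    have key := abs_realize_sub_le Φ ((Nat.le_add_left _ _).trans hn) hC.2 (by nlinarith)
      (J := J) (by omega)
      (x := fun i => requ ((A.mulVec x + b) i)) (y := fun i => requ ((A.mulVec y + b) i))
      (B := ((d + 1) * C) ^ 2) (D := 2 * ((d + 1) * C) * ((d + 1) * C * D)) (one_le_pow₀ hB')
      (by positivity)
      (fun j => by rw [abs_of_nonneg (requ_nonneg _)]; exact requ_le (hz1 hx j))
      (fun j => by rw [abs_of_nonneg (requ_nonneg _)]; exact requ_le (hz1 hy j))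
      (fun j => (abs_requ_sub_le (hz1 hx j) (hz1 hy j)).trans
        (by gcongr; exact (hz j).trans (by gcongr; linarith))) i
    refine key.trans (le_of_eq ?_)
    obtain ⟨e, he⟩ : ∃ e, 2 ^ J = e + 1 :=
      ⟨2 ^ J - 1, by have := Nat.one_le_two_pow (n := J); omega⟩
    have e1 : 2 ^ (J + 1) - 1 = 2 * e + 1 := by rw [pow_succ]; omega
    have e2 : 2 ^ (J + 2) - 1 = 4 * e + 3 := by rw [pow_succ, pow_succ]; omega
    have e3 : 2 ^ J - 1 = e := by omega
    have e4 : 2 ^ (J + 1) = 2 * e + 2 := by omega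
    rw [e1, e2, e3]
    generalize hq : (2 : ℕ) ^ (J + 1) = q at e4
    subst e4
    generalize (d : ℝ) + 1 = δ
    ring

end Network

/-! ### Functions in the unit ball oscillate slowly -/

/-- The cube is convex with nonempty interior, so every nonempty relatively open subset meets the
interior. This is what turns essential suprema of continuous functions into pointwise bounds. -/
instance isOpenPosMeasure_cubeVolume (d : ℕ) : (cubeVolume d).IsOpenPosMeasure := by
  refine ⟨fun O hO hne => ?_⟩
  obtain ⟨V, hV, rfl⟩ := isOpen_induced_iff.1 hO
  obtain ⟨x, hx⟩ := hne
  have hint : (interior (Cube d)).Nonempty := by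
    rw [Cube, ← Set.pi_univ_Icc, interior_pi_set Set.finite_univ]
    exact ⟨fun _ => 1 / 2, fun i _ => by simp [interior_Icc]; norm_num⟩
  have hcl : (x : Fin d → ℝ) ∈ closure (interior (Cube d)) := by
    rw [(convex_Icc (𝕜 := ℝ) (0 : Fin d → ℝ) 1
      ).closure_interior_eq_closure_of_nonempty_interior hint]
    exact subset_closure x.2
  have hW : (V ∩ interior (Cube d)).Nonempty := mem_closure_iff.1 hcl V hV hx
  have hpos := (hV.inter isOpen_interior).measure_pos volume hW
  rw [cubeVolume, Measure.comap_apply _ Subtype.val_injective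
    (fun s hs => (MeasurableEmbedding.subtype_coe measurableSet_Icc).measurableSet_image.2 hs) _
    hO.measurableSet, Subtype.image_preimage_coe]
  refine (hpos.trans_le (measure_mono fun y hy => ?_)).ne'
  exact ⟨interior_subset hy.2, hy.1⟩

theorem norm_le_of_eLpNorm_top_le {d : ℕ} {f : Cube d → ℝ} (hf : Continuous f) {r : ℝ}
    (h : eLpNorm f ∞ (cubeVolume d) ≤ ENNReal.ofReal r) (hr : 0 ≤ r) (x : Cube d) : |f x| ≤ r := by
  have hae : ∀ᵐ y ∂(cubeVolume d), ‖f y‖ₑ ≤ ENNReal.ofReal r := by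
    filter_upwards [ae_le_eLpNormEssSup (f := f) (μ := cubeVolume d)] with y hy
    rw [eLpNorm_exponent_top] at h
    exact hy.trans h
  have hcl : IsClosed {y | |f y| ≤ r} := isClosed_le hf.abs continuous_const
  have huniv : {y | |f y| ≤ r} = Set.univ := by
    rw [← hcl.ae_eq_univ_iff_eq (μ := cubeVolume d), Filter.eventuallyEq_univ]
    filter_upwards [hae] with y hy
    rw [← ofReal_norm, ENNReal.ofReal_le_ofReal_iff hr] at hy
    exact hy
  exact huniv.ge (Set.mem_univ x)

/-- Neither the infimum over s nor the one over networks need be attained; giving away a factor 2 in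
each produces the 4. -/
theorem exists_network_of_mem_unitBall {d : ℕ} {ℓ c : ℕ+ → ℕ∞} {α : ℝ} {v : C(Cube d, ℝ)}
    (hv : v ∈ unitBall d ℓ c α) (n : ℕ+) :
    ∃ s : ℝ, 0 < s ∧ s ≤ 2 ∧ ∃ g ∈ networkClass d ℓ c n,
      ∀ x : Cube d, |v x - s * g x| ≤ 4 * ((n : ℕ) : ℝ) ^ (-α) := by
  have hn : (0 : ℝ) < ((n : ℕ) : ℝ) := by exact_mod_cast n.pos
  have hna : 0 < ((n : ℕ) : ℝ) ^ (-α) := by positivity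
  have h2 : approxNorm ℓ c α ∞ v < 2 := hv.2.trans_lt (by norm_num)
  obtain ⟨t, ⟨s, hs, hΓ, rfl⟩, hst⟩ := sInf_lt_iff.1 h2
  have hs2 : s < 2 := by
    have : ENNReal.ofReal s < ENNReal.ofReal 2 := by simpa using hst
    exact (ENNReal.ofReal_lt_ofReal_iff (by norm_num)).1 this
  have h1 := (le_iSup (fun n : ℕ+ => ENNReal.ofReal (((n : ℕ) : ℝ) ^ α) *
    lpDist ∞ (fun x => v x / s) (networkClass d ℓ c n)) n).trans ((le_max_right _ _).trans hΓ)
  have h3 : lpDist ∞ (fun x => v x / s) (networkClass d ℓ c n) <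
      ENNReal.ofReal (2 * ((n : ℕ) : ℝ) ^ (-α)) := by
    refine lt_of_le_of_lt (b := ENNReal.ofReal (((n : ℕ) : ℝ) ^ (-α))) ?_
      ((ENNReal.ofReal_lt_ofReal_iff (by positivity)).2 (by linarith))
    rw [Real.rpow_neg hn.le, ENNReal.ofReal_inv_of_pos (by positivity)]
    rw [mul_comm] at h1
    simpa using ENNReal.le_div_iff_mul_le (Or.inl (by simp; positivity)) (Or.inl (by simp)) |>.2 h1
  rw [lpDist] at h3
  simp only [iInf_lt_iff] at h3
  obtain ⟨g, hg, hlt⟩ := h3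
  refine ⟨s, hs, hs2.le, g, hg, fun x => ?_⟩
  have hgc : Continuous g := by
    obtain ⟨Φ, -, -, -, rfl⟩ := hg
    exact (continuous_apply 0).comp Φ.continuous_realize
  have h4 := norm_le_of_eLpNorm_top_le
    ((v.continuous.div_const s).sub (hgc.comp continuous_subtype_val)) hlt.le (by positivity) x
  have e : v x - s * g x = s * (v x / s - g x) := by field_simp
  rw [e, abs_mul, abs_of_pos hs]
  calc s * |v x / s - g x| ≤ 2 * (2 * ((n : ℕ) : ℝ) ^ (-α)) :=
        mul_le_mul hs2.le h4 (abs_nonneg _) (by norm_num)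
    _ = _ := by ring

theorem pow_mul_rpow_le {a b : ℕ} {x C K p q : ℝ} (hx : 1 ≤ x) (hC : 0 ≤ C) (hK : 0 ≤ K)
    (hle : C ≤ K * x ^ p) (hq : a + p * b ≤ q) : x ^ a * C ^ b ≤ K ^ b * x ^ q := by
  have hx0 : 0 < x := by linarith
  calc x ^ a * C ^ b ≤ x ^ a * (K * x ^ p) ^ b := by gcongr
    _ = K ^ b * x ^ (a + p * b) := by
        rw [Real.rpow_add hx0, Real.rpow_natCast, Real.rpow_mul hx0.le, Real.rpow_natCast]
        ring
    _ ≤ _ := by gcongr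

/-- The Lipschitz constants of the networks of depth at most `L` grow at most like `n ^ γ`. -/
theorem exists_lipschitz_networkClass {d : ℕ} {ℓ c : ℕ+ → ℕ∞} {θ κ : ℝ} (hc : HasGrowth c θ κ)
    {J : ℕ} (hℓ : ∀ n, ℓ n ≤ ((J + 2 : ℕ) : ℕ∞)) :
    ∃ K : ℝ, 0 < K ∧ ∀ n : ℕ+, ∀ g ∈ networkClass d ℓ c n, ∀ x ∈ Cube d, ∀ y ∈ Cube d, ∀ D : ℝ,
      0 ≤ D → (∀ j, |x j - y j| ≤ D) →
      |g x - g y| ≤ K * ((n : ℕ) : ℝ) ^ (((2 : ℝ) ^ (J + 2) - 1) * (θ + 1 / 2)) * D := by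
  obtain ⟨C, hcC, hC1, a, b, ha, hb, hg⟩ := hc.exists_nat
  have hX : (1 : ℝ) ≤ 2 ^ (J + 1) := one_le_pow₀ (by norm_num)
  have hX2 : (2 : ℝ) ^ (J + 2) = 2 * 2 ^ (J + 1) := by ring
  have hpos : (0 : ℝ) < 2 ^ (J + 2) - 1 := by linarith
  -- This ε satisfies (2^(J+2) - 1) ε = 1/2, exactly the slack in the exponent of n.
  obtain ⟨K, hK, hCK⟩ := le_mul_rpow_of_growth hb
    (ε := 1 / (2 * ((2 : ℝ) ^ (J + 2) - 1))) (by positivity) fun n => (hg n).2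
  refine ⟨2 ^ (J + 1) * (d + 1 : ℝ) ^ (2 ^ (J + 1)) * K ^ (2 ^ (J + 2) - 1), by positivity, ?_⟩
  rintro n _ ⟨Φ, hW, hL, hM, rfl⟩ x hx y hy D hD hxy
  have hn1 : (1 : ℝ) ≤ ((n : ℕ) : ℝ) := by exact_mod_cast n.pos
  have hM' : Φ.maxWeight ≤ (C n : ℝ≥0) := by
    rw [hcC n, ENat.toENNReal_coe, ← ENNReal.coe_natCast, ENNReal.coe_le_coe] at hM
    exact hM
  have hL' : Φ.numLayers ≤ J + 2 := by exact_mod_cast hL.trans (hℓ n)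
  refine (Φ.abs_realize_sub_le_of_mem_cube hW hM' n.pos (by exact_mod_cast hC1 n) hL' hx hy hD hxy
    0).trans (mul_le_mul_of_nonneg_right ?_ hD)
  refine (mul_le_mul_of_nonneg_left ?_ (by positivity)).trans (mul_assoc _ _ _).ge
  have e1 : ((2 ^ (J + 1) - 1 : ℕ) : ℝ) = 2 ^ (J + 1) - 1 := by
    rw [Nat.cast_sub Nat.one_le_two_pow]; simp
  have e2 : ((2 ^ (J + 2) - 1 : ℕ) : ℝ) = 2 ^ (J + 2) - 1 := by
    rw [Nat.cast_sub Nat.one_le_two_pow]; simp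
  refine pow_mul_rpow_le (p := θ + 1 / (2 * ((2 : ℝ) ^ (J + 2) - 1))) hn1 (by positivity) hK.le
    (by simpa using hCK n) ?_
  rw [e1, e2, add_mul]
  have : 1 / (2 * ((2 : ℝ) ^ (J + 2) - 1)) * (2 ^ (J + 2) - 1) = 1 / 2 := by
    field_simp
  rw [this, hX2]
  apply le_of_eq
  ring

theorem abs_sub_le_of_mem_unitBall {d : ℕ} {ℓ c : ℕ+ → ℕ∞} {α γ K : ℝ}
    (hK : ∀ n : ℕ+, ∀ g ∈ networkClass d ℓ c n, ∀ x ∈ Cube d, ∀ y ∈ Cube d, ∀ D : ℝ,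
      0 ≤ D → (∀ j, |x j - y j| ≤ D) → |g x - g y| ≤ K * ((n : ℕ) : ℝ) ^ γ * D)
    {v : C(Cube d, ℝ)} (hv : v ∈ unitBall d ℓ c α) (n : ℕ+) {x y : Cube d} {D : ℝ} (hD : 0 ≤ D)
    (hxy : ∀ j, |(x : Fin d → ℝ) j - (y : Fin d → ℝ) j| ≤ D) :
    |v x - v y| ≤ 8 * ((n : ℕ) : ℝ) ^ (-α) + 2 * (K * ((n : ℕ) : ℝ) ^ γ * D) := by
  obtain ⟨s, hs, hs2, g, hg, h⟩ := exists_network_of_mem_unitBall hv n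
  have hgl := hK n g hg x x.2 y y.2 D hD hxy
  have h1 := h x
  have h2 := h y
  have h3 : |s * (g x - g y)| ≤ 2 * (K * ((n : ℕ) : ℝ) ^ γ * D) := by
    rw [abs_mul, abs_of_pos hs]
    exact mul_le_mul hs2 hgl (abs_nonneg _) (by norm_num)
  rw [abs_le] at *
  constructor <;> linarith

/-! ### Deterministic methods -/

/-- The method returns any element of U that interpolates the data. Unused sample slots repeat
nodes. -/
theorem detError_le {d : ℕ} {U : Set C(Cube d, ℝ)} {m : ℕ+} {ι : Type} [Fintype ι] [Nonempty ι]
    (hcard : Fintype.card ι ≤ (m : ℕ)) (x : ι → Cube d) {r : ℝ}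
    (h : ∀ u ∈ U, ∀ v ∈ U, (∀ i, u (x i) = v (x i)) → ∀ y, |u y - v y| ≤ r) :
    detError m U (iotaInf U) ≤ ENNReal.ofReal r := by
  classical
  obtain ⟨e⟩ : Nonempty (ι ↪ Fin m) := by
    rw [Function.Embedding.nonempty_iff_card_le]
    simpa using hcard
  let z : Fin m → Cube d := fun i => x (Function.invFun e i)
  have hz : ∀ i, z (e i) = x i := fun i => by
    simp only [z, Function.leftInverse_invFun e.injective i]
  let Q : (Fin m → ℝ) → C(Cube d, ℝ) := fun p =>
    if hp : ∃ u ∈ U, ∀ i, u (z i) = p i then hp.choose else 0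
  refine iInf₂_le_of_le (fun v : U => Q fun i => (v : C(Cube d, ℝ)) (z i)) ⟨z, Q, fun v => rfl⟩
    (iSup_le fun v => ?_)
  have hp : ∃ u ∈ U, ∀ i, u (z i) = (v : C(Cube d, ℝ)) (z i) := ⟨v, v.2, fun _ => rfl⟩
  have hQ : Q (fun i => (v : C(Cube d, ℝ)) (z i)) = hp.choose := dif_pos hp
  obtain ⟨hU, hval⟩ := hp.choose_spec
  have key := h _ hU v v.2 fun i => by rw [← hz]; exact hval _
  have hr : 0 ≤ r := (abs_nonneg _).trans (key ⟨0, by simp⟩)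
  simp only [hQ, iotaInf]
  rw [← ofReal_norm]
  refine ENNReal.ofReal_le_ofReal ((ContinuousMap.norm_le _ hr).2 fun y => ?_)
  exact key y

theorem exists_grid_point {d q : ℕ} (hq : 0 < q) (x : Cube d) :
    ∃ k : Fin d → Fin q, ∀ j, |(x : Fin d → ℝ) j - (k j : ℕ) / (q : ℝ)| ≤ 1 / q := by
  have hq' : (0 : ℝ) < q := by exact_mod_cast hq
  -- The cap at q - 1 only acts when the coordinate equals 1.
  refine ⟨fun j => ⟨min ⌊(x : Fin d → ℝ) j * q⌋₊ (q - 1), by omega⟩, fun j => ?_⟩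
  have h0 : 0 ≤ (x : Fin d → ℝ) j := x.2.1 j
  have h1 : (x : Fin d → ℝ) j ≤ 1 := x.2.2 j
  have e : (x : Fin d → ℝ) j - (min ⌊(x : Fin d → ℝ) j * q⌋₊ (q - 1) : ℕ) / (q : ℝ) =
      ((x : Fin d → ℝ) j * q - (min ⌊(x : Fin d → ℝ) j * q⌋₊ (q - 1) : ℕ)) / q := by
    field_simp
  simp only [e]
  rw [abs_div, abs_of_pos hq', div_le_div_iff_of_pos_right hq']
  have hfl := Nat.floor_le (mul_nonneg h0 hq'.le)
  have hlt := Nat.lt_floor_add_one ((x : Fin d → ℝ) j * q)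
  rcases le_total ⌊(x : Fin d → ℝ) j * q⌋₊ (q - 1) with h | h
  · rw [min_eq_left h, abs_le]
    constructor <;> linarith
  · rw [min_eq_right h, Nat.cast_sub hq]
    have : ((q - 1 : ℕ) : ℝ) ≤ ⌊(x : Fin d → ℝ) j * q⌋₊ := by exact_mod_cast h
    rw [Nat.cast_sub hq] at this
    push_cast at this ⊢
    rw [abs_le]
    constructor <;> nlinarith

theorem exists_nat_near {x : ℝ} (hx : 1 ≤ x) : ∃ n : ℕ, 0 < n ∧ (n : ℝ) ≤ x ∧ x ≤ 2 * n := by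
  have h1 : 1 ≤ ⌊x⌋₊ := (Nat.one_le_floor_iff x).2 hx
  refine ⟨⌊x⌋₊, h1, Nat.floor_le (by linarith), ?_⟩
  have h2 : (1 : ℝ) ≤ ⌊x⌋₊ := by exact_mod_cast h1
  linarith [Nat.lt_floor_add_one x]

theorem exists_detError_le {d : ℕ} (hd : 1 ≤ d) {α γ K : ℝ} (hα : 0 < α) (hγ : 0 < γ) (hK : 0 < K)
    {U : Set C(Cube d, ℝ)}
    (hU : ∀ v ∈ U, ∀ n : ℕ+, ∀ (x y : Cube d) (D : ℝ), 0 ≤ D →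
      (∀ j, |(x : Fin d → ℝ) j - (y : Fin d → ℝ) j| ≤ D) →
      |v x - v y| ≤ 8 * ((n : ℕ) : ℝ) ^ (-α) + 2 * (K * ((n : ℕ) : ℝ) ^ γ * D)) :
    ∃ C : ℝ, 0 < C ∧ ∀ m : ℕ+, detError m U (iotaInf U) ≤
      ENNReal.ofReal (C * ((m : ℕ) : ℝ) ^ (-(1 / (d : ℝ) * (α / (α + γ))))) := by
  set β := α / (α + γ) with hβ
  have hβ0 : 0 < β := by positivity
  have hd' : (0 : ℝ) < d := by exact_mod_cast hd
  refine ⟨2 * (8 * 2 ^ α + 2 * K) * 2 ^ β, by positivity, fun m => ?_⟩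
  have hm1 : (1 : ℝ) ≤ ((m : ℕ) : ℝ) := by exact_mod_cast m.pos
  have hm0 : (0 : ℝ) < ((m : ℕ) : ℝ) := by linarith
  -- A grid with q ≈ m^(1/d) points per axis uses at most m samples.
  obtain ⟨q, hq0, hqm, hmq⟩ := exists_nat_near
    (Real.one_le_rpow hm1 (by positivity : (0 : ℝ) ≤ 1 / d))
  have hq1 : (1 : ℝ) ≤ q := by exact_mod_cast hq0
  have hqp : (0 : ℝ) < q := by linarith
  -- Up to constants, n solves n^(-α) = n^γ / q.
  obtain ⟨n, hn0, hnq, hqn⟩ := exists_nat_near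
    (Real.one_le_rpow hq1 (by positivity : (0 : ℝ) ≤ 1 / (α + γ)))
  have hnp : (0 : ℝ) < n := by exact_mod_cast hn0
  have hcard : q ^ d ≤ (m : ℕ) := by
    have : (q : ℝ) ^ d ≤ (((m : ℕ) : ℝ) ^ (1 / (d : ℝ))) ^ d := by gcongr
    rw [← Real.rpow_natCast (((m : ℕ) : ℝ) ^ (1 / (d : ℝ))), ← Real.rpow_mul hm0.le,
      one_div_mul_cancel hd'.ne', Real.rpow_one] at this
    exact_mod_cast this
  have : Nonempty (Fin q) := ⟨⟨0, hq0⟩⟩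
  let x : (Fin d → Fin q) → Cube d := fun k => ⟨fun j => (k j : ℕ) / (q : ℝ), fun j => by
    simp only [Pi.zero_apply]; positivity, fun j => by
    simp only [Pi.one_apply]
    rw [div_le_one hqp]
    exact_mod_cast (k j).2.le⟩
  -- approximation and oscillation balance at this choice of `n`
  have hb1 : (n : ℝ) ^ (-α) ≤ 2 ^ α * (q : ℝ) ^ (-β) := by
    calc (n : ℝ) ^ (-α) = 2 ^ α * (2 * n : ℝ) ^ (-α) := by
          rw [Real.mul_rpow (by norm_num) hnp.le, ← mul_assoc, ← Real.rpow_add (by norm_num)]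
          simp
      _ ≤ 2 ^ α * ((q : ℝ) ^ (1 / (α + γ))) ^ (-α) := by
          refine mul_le_mul_of_nonneg_left ?_ (by positivity)
          exact Real.rpow_le_rpow_of_nonpos (by positivity) hqn (by linarith)
      _ = _ := by
          rw [← Real.rpow_mul hqp.le]
          congr 2
          rw [hβ]; ring
  have hb2 : (n : ℝ) ^ γ * (1 / q) ≤ (q : ℝ) ^ (-β) := by
    calc (n : ℝ) ^ γ * (1 / q) ≤ ((q : ℝ) ^ (1 / (α + γ))) ^ γ * (q : ℝ) ^ (-1 : ℝ) := by
          rw [Real.rpow_neg_one, one_div]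
          gcongr
      _ = _ := by
          rw [← Real.rpow_mul hqp.le, ← Real.rpow_add hqp]
          congr 1
          rw [hβ]; field_simp; ring
  have hb3 : (q : ℝ) ^ (-β) ≤ 2 ^ β * ((m : ℕ) : ℝ) ^ (-(1 / (d : ℝ) * β)) := by
    calc (q : ℝ) ^ (-β) = 2 ^ β * (2 * q : ℝ) ^ (-β) := by
          rw [Real.mul_rpow (by norm_num) hqp.le, ← mul_assoc, ← Real.rpow_add (by norm_num)]
          simp
      _ ≤ 2 ^ β * (((m : ℕ) : ℝ) ^ (1 / (d : ℝ))) ^ (-β) := by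
          refine mul_le_mul_of_nonneg_left ?_ (by positivity)
          exact Real.rpow_le_rpow_of_nonpos (by positivity) hmq (by linarith)
      _ = _ := by
          rw [← Real.rpow_mul hm0.le]
          congr 2
          ring
  have hosc : ∀ v ∈ U, ∀ y z : Cube d, (∀ j, |(y : Fin d → ℝ) j - (z : Fin d → ℝ) j| ≤ 1 / q) →
      |v y - v z| ≤ (8 * 2 ^ α + 2 * K) * 2 ^ β * ((m : ℕ) : ℝ) ^ (-(1 / (d : ℝ) * β)) := by
    intro v hv y z hyz
    refine (hU v hv ⟨n, hn0⟩ y z (1 / q) (by positivity) hyz).trans ?_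
    calc 8 * (n : ℝ) ^ (-α) + 2 * (K * (n : ℝ) ^ γ * (1 / q))
        = 8 * (n : ℝ) ^ (-α) + 2 * K * ((n : ℝ) ^ γ * (1 / q)) := by ring
      _ ≤ 8 * (2 ^ α * (q : ℝ) ^ (-β)) + 2 * K * (q : ℝ) ^ (-β) := by gcongr
      _ = (8 * 2 ^ α + 2 * K) * (q : ℝ) ^ (-β) := by ring
      _ ≤ (8 * 2 ^ α + 2 * K) * (2 ^ β * ((m : ℕ) : ℝ) ^ (-(1 / (d : ℝ) * β))) := by gcongr
      _ = _ := by ring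
  refine detError_le (by simpa using hcard) x fun u hu v hv huv y => ?_
  obtain ⟨k, hk⟩ := exists_grid_point hq0 y
  have h1 := hosc u hu y (x k) hk
  have h2 := hosc v hv y (x k) hk
  have h3 := huv k
  rw [abs_le] at *
  constructor <;> linarith

/-- A deterministic method is a random one over a one-point probability space. -/
theorem mcError_le_detError {d : ℕ} {Y : Type} [NormedAddCommGroup Y] (m : ℕ+)
    (U : Set C(Cube d, ℝ)) (S : U → Y) : mcError.{u} m U S ≤ detError m U S := by
  refine le_iInf₂ fun A hA => sInf_le ?_
  refine ⟨PUnit, ⊤, @Measure.dirac PUnit ⊤ PUnit.unit, fun _ => A, fun _ => m, ?_, ?_, ?_⟩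
  · exact @Measure.dirac.isProbabilityMeasure _ ⊤ _
  · exact ⟨measurable_const, by simp, fun v => @measurable_const _ _ (borel Y) _ _, fun _ => hA⟩
  · simp [enorm_sub_rev]

theorem optimalOrder_mono {e f : ℕ+ → ℝ≥0∞} (h : ∀ m, e m ≤ f m) :
    optimalOrder f ≤ optimalOrder e := by
  refine sSup_le_sSup ?_
  rintro _ ⟨β, hβ, rfl, C, hC, hle⟩
  exact ⟨β, hβ, rfl, C, hC, fun m => (h m).trans (hle m)⟩

/-! ### Localized networks -/

namespace Network

/-- Two blocks of `N` neurons each; every layer multiplies the common value in a block by `N * C`,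
and squares it, and the output neuron subtracts the second block from the first. -/
def twoBlocks {N : ℕ} (hN : 0 < N + N) (C s : ℝ) : ℕ → Network (N + N) 1
  | 0 => last hN one_pos
      (Matrix.of fun _ => Fin.append (fun _ => s * C) (fun _ => -(s * C))) 0
  | j + 1 => cons hN
      (Matrix.of (Fin.append (fun _ => Fin.append (fun _ => C) (fun _ => 0))
        (fun _ => Fin.append (fun _ => 0) (fun _ => C)))) 0 (twoBlocks hN C s j)

variable {N : ℕ} (hN : 0 < N + N) {C s : ℝ}

theorem numLayers_twoBlocks (j : ℕ) : (twoBlocks hN C s j).numLayers = j + 1 := by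
  induction j with
  | zero => rfl
  | succ j ih => simp only [twoBlocks, numLayers, ih]; omega

theorem numWeights_twoBlocks_le (j : ℕ) :
    (twoBlocks hN C s j).numWeights ≤ j * ((N + N) * (N + N) + (N + N)) + (N + N + 1) := by
  induction j with
  | zero => exact (numNonzero_le _ _).trans (by omega)
  | succ j ih =>
    simp only [twoBlocks, numWeights]
    refine (add_le_add (numNonzero_le _ _) ih).trans (le_of_eq (by ring))

theorem maxWeight_twoBlocks_le {M : ℝ≥0} (hC : |C| ≤ M) (hs : |s| ≤ 1) (j : ℕ) :
    (twoBlocks hN C s j).maxWeight ≤ M := by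
  have hsC : |s * C| ≤ M := by
    rw [abs_mul]
    exact (mul_le_of_le_one_left (abs_nonneg _) hs).trans hC
  induction j with
  | zero =>
    refine maxEntry_le_iff.2 ⟨fun i k => ?_, fun i => by simp⟩
    refine Fin.addCases (fun k => ?_) (fun k => ?_) k <;> simpa [-Fin.natAdd_eq_addNat] using hsC
  | succ j ih =>
    simp only [twoBlocks, maxWeight]
    refine max_le (maxEntry_le_iff.2 ⟨fun i k => ?_, fun i => by simp⟩) ih
    refine Fin.addCases (fun i => ?_) (fun i => ?_) i <;>
      refine Fin.addCases (fun k => ?_) (fun k => ?_) k <;> simp [hC, -Fin.natAdd_eq_addNat]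

/-- Each layer gains a factor NC, which every later activation squares; the gains add up to the
exponent 1 + 2 + ⋯ + 2^j = 2^(j+1) - 1. -/
theorem realize_twoBlocks (hC : 0 ≤ C) (j : ℕ) {p q : ℝ} (hp : 0 ≤ p) (hq : 0 ≤ q) :
    (twoBlocks hN C s j).realize requ (Fin.append (fun _ => p) (fun _ => q)) 0 =
      s * (N * C) ^ (2 ^ (j + 1) - 1) * (p ^ 2 ^ j - q ^ 2 ^ j) := by
  induction j generalizing p q with
  | zero =>
    simp only [twoBlocks, realize]
    simp [-Fin.natAdd_eq_addNat, Matrix.mulVec, dotProduct, Fin.sum_univ_add]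
    ring
  | succ j ih =>
    have e : (fun i => requ (((Matrix.of (Fin.append (fun _ : Fin N => Fin.append
        (fun _ : Fin N => C) (fun _ : Fin N => 0)) (fun _ : Fin N => Fin.append
        (fun _ : Fin N => 0) (fun _ : Fin N => C)))).mulVec
        (Fin.append (fun _ => p) (fun _ => q)) + 0) i)) =
        Fin.append (fun _ => (N * C * p) ^ 2) (fun _ => (N * C * q) ^ 2) := by
      funext i
      refine Fin.addCases (fun i => ?_) (fun i => ?_) i
      · rw [Fin.append_left, ← requ_of_nonneg (by positivity)]
        simp [-Fin.natAdd_eq_addNat, Matrix.mulVec, dotProduct, Fin.sum_univ_add, mul_assoc]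
      · rw [Fin.append_right, ← requ_of_nonneg (by positivity)]
        simp [-Fin.natAdd_eq_addNat, Matrix.mulVec, dotProduct, Fin.sum_univ_add, mul_assoc]
    simp only [twoBlocks, realize]
    rw [e, ih (by positivity) (by positivity)]
    have e1 : 2 ^ (j + 1 + 1) - 1 = (2 ^ (j + 1) - 1) + 2 ^ (j + 1) := by
      have := Nat.one_le_two_pow (n := j + 1)
      rw [pow_succ 2 (j + 1)]; omega
    rw [e1, pow_add, ← pow_mul, ← pow_mul, ← pow_succ', mul_pow (N * C) p, mul_pow (N * C) q]
    ring

end Network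

/-- A radial bump around `a`, supported in the ball of radius `w`. -/
def bump {d : ℕ} (w : ℝ) (a x : Fin d → ℝ) : ℝ := requ (w ^ 2 - ∑ i, (x i - a i) ^ 2)

theorem bump_le {d : ℕ} (w : ℝ) (a x : Fin d → ℝ) : bump w a x ≤ w ^ 4 := by
  have h : 0 ≤ ∑ i, (x i - a i) ^ 2 := Finset.sum_nonneg fun _ _ => sq_nonneg _
  rcases le_total 0 (w ^ 2 - ∑ i, (x i - a i) ^ 2) with h0 | h0
  · rw [bump, requ_of_nonneg h0]
    calc _ ≤ (w ^ 2) ^ 2 := pow_le_pow_left₀ h0 (by linarith) 2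
      _ = _ := by ring
  · rw [bump, requ_of_nonpos h0]; positivity

theorem bump_self {d : ℕ} (w : ℝ) (a : Fin d → ℝ) : bump w a a = w ^ 4 := by
  simp only [bump, sub_self]
  rw [requ_of_nonneg (by simp; positivity)]
  simp; ring

theorem bump_eq_zero {d : ℕ} {w : ℝ} (hw : 0 ≤ w) {a x : Fin d → ℝ} {i : Fin d}
    (h : w ≤ |x i - a i|) : bump w a x = 0 := by
  refine requ_of_nonpos (sub_nonpos.2 ?_)
  calc w ^ 2 ≤ |x i - a i| ^ 2 := pow_le_pow_left₀ hw h 2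
    _ = (x i - a i) ^ 2 := sq_abs _
    _ ≤ _ := Finset.single_le_sum (f := fun i => (x i - a i) ^ 2) (fun _ _ => sq_nonneg _)
        (Finset.mem_univ i)

/-- Two neurons per coordinate give an exact square, so two layers compute a radial bump. -/
theorem requ_add_requ_neg (x : ℝ) : requ x + requ (-x) = x ^ 2 := by
  rcases le_total 0 x with h | h
  · rw [requ_of_nonneg h, requ_of_nonpos (by linarith)]; ring
  · rw [requ_of_nonpos h, requ_of_nonneg (by linarith)]; ring

namespace Network

/-- A network with `j + 4` layers which is localized at `a`. -/
def localized {d N : ℕ} (hd : 0 < d) (hN : 0 < N + N) (C s w : ℝ) (a : Fin d → ℝ) (j : ℕ) :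
    Network d 1 :=
  cons hd (Matrix.of (Fin.append (fun i k => (1 : Matrix (Fin d) (Fin d) ℝ) i k)
    (fun i k => -(1 : Matrix (Fin d) (Fin d) ℝ) i k)))
    (Fin.append (-a) a) <|
  cons (Nat.add_pos_left hd d) (Matrix.of fun (_ : Fin 1) _ => -1) (fun _ => w ^ 2) <|
  cons one_pos (Matrix.of (Fin.append (fun _ _ => C) (fun _ _ => 0))) (fun _ => C) <|
  twoBlocks hN C s j

variable {d N : ℕ} (hd : 0 < d) (hN : 0 < N + N) {C s w : ℝ} {a : Fin d → ℝ} {j : ℕ}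

theorem numLayers_localized : (localized hd hN C s w a j).numLayers = j + 4 := by
  simp only [localized, numLayers, numLayers_twoBlocks]
  omega

theorem numWeights_localized_le :
    (localized hd hN C s w a j).numWeights ≤ (2 * d ^ 2 + 4 * d + 8 + 6 * j) * N ^ 2 := by
  simp only [localized, numWeights]
  refine (add_le_add (numNonzero_le _ _) (add_le_add (numNonzero_le _ _)
    (add_le_add (numNonzero_le _ _) (numWeights_twoBlocks_le hN j)))).trans ?_
  have h1 : 1 ≤ N := by omega
  have h2 : N ≤ N ^ 2 := Nat.le_self_pow two_ne_zero N
  have h3 : j * N ≤ j * N ^ 2 := Nat.mul_le_mul_left _ h2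
  have h4 : (2 * d ^ 2 + 4 * d + 2) * 1 ≤ (2 * d ^ 2 + 4 * d + 2) * N ^ 2 :=
    Nat.mul_le_mul_left _ (h1.trans h2)
  nlinarith

theorem maxWeight_localized_le {M : ℝ≥0} (hM : 1 ≤ M) (hC : |C| ≤ M) (hs : |s| ≤ 1) (hw : |w| ≤ 1)
    (ha : a ∈ Cube d) : (localized hd hN C s w a j).maxWeight ≤ M := by
  have hM' : (1 : ℝ) ≤ M := by exact_mod_cast hM
  have ha' : ∀ i, |a i| ≤ M := fun i => by
    rw [abs_of_nonneg (ha.1 i)]; exact (ha.2 i).trans hM'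
  have h1 : ∀ i k, |(1 : Matrix (Fin d) (Fin d) ℝ) i k| ≤ M := fun i k => by
    rw [Matrix.one_apply]
    split_ifs <;> simp [hM']
  simp only [localized, maxWeight, max_le_iff]
  refine ⟨maxEntry_le_iff.2 ⟨fun i k => ?_, fun i => ?_⟩,
    maxEntry_le_iff.2 ⟨fun i k => by simp [hM'], fun i => ?_⟩,
    maxEntry_le_iff.2 ⟨fun i k => ?_, fun i => hC⟩, maxWeight_twoBlocks_le hN hC hs j⟩
  · refine Fin.addCases (fun i => ?_) (fun i => ?_) i <;> simpa [-Fin.natAdd_eq_addNat] using h1 i k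
  · refine Fin.addCases (fun i => ?_) (fun i => ?_) i <;> simpa [-Fin.natAdd_eq_addNat] using ha' i
  · rw [abs_pow]
    exact (pow_le_one₀ (abs_nonneg _) hw).trans hM'
  · refine Fin.addCases (fun i => ?_) (fun i => ?_) i <;> simp [hC, -Fin.natAdd_eq_addNat]

/-- Squaring a small bump b repeatedly would destroy it. One block therefore carries 1 + b and the
other carries 1; their powers differ by (1+b)^K - 1 ≥ Kb with K = 2^(j+1), so the height stays
linear in b while the gain compounds, and the output vanishes wherever b does. -/
theorem realize_localized (hC : 0 ≤ C) (x : Fin d → ℝ) :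
    (localized hd hN C s w a j).realize requ x 0 =
      s * ((N * C) ^ (2 ^ (j + 1) - 1) * C ^ 2 ^ (j + 1)) *
        ((1 + bump w a x) ^ 2 ^ (j + 1) - 1) := by
  have e1 : (fun i => requ (((Matrix.of (Fin.append (fun i k => (1 : Matrix (Fin d) (Fin d) ℝ) i k)
      (fun i k => -(1 : Matrix (Fin d) (Fin d) ℝ) i k))).mulVec x + Fin.append (-a) a) i)) =
      Fin.append (fun i => requ (x i - a i)) (fun i => requ (-(x i - a i))) := by
    funext i
    refine Fin.addCases (fun i => ?_) (fun i => ?_) i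
    · simp [-Fin.natAdd_eq_addNat, Matrix.mulVec, dotProduct, Matrix.one_apply, sub_eq_add_neg]
    · simp [-Fin.natAdd_eq_addNat, Matrix.mulVec, dotProduct, Matrix.one_apply,
        sub_eq_add_neg, add_comm]
  have e2 : (fun i => requ (((Matrix.of fun (_ : Fin 1) (_ : Fin (d + d)) => (-1 : ℝ)).mulVec
      (Fin.append (fun i => requ (x i - a i)) (fun i => requ (-(x i - a i)))) +
      (fun _ => w ^ 2 : Fin 1 → ℝ)) i)) = fun _ => bump w a x := by
    funext i
    simp only [bump, ← requ_add_requ_neg, Finset.sum_add_distrib]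
    congr 1
    simp [-Fin.natAdd_eq_addNat, Matrix.mulVec, dotProduct, Fin.sum_univ_add]
    ring
  have hb : 0 ≤ bump w a x := requ_nonneg _
  have e3 : (fun i => requ (((Matrix.of (Fin.append (fun (_ : Fin N) (_ : Fin 1) => C)
      (fun (_ : Fin N) (_ : Fin 1) => 0))).mulVec (fun _ => bump w a x) +
      (fun _ => C : Fin (N + N) → ℝ)) i)) =
      Fin.append (fun _ => (C * (1 + bump w a x)) ^ 2) (fun _ => C ^ 2) := by
    funext i
    refine Fin.addCases (fun i => ?_) (fun i => ?_) i
    · rw [Fin.append_left, ← requ_of_nonneg (by positivity)]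
      simp [-Fin.natAdd_eq_addNat, Matrix.mulVec, dotProduct]
      ring_nf
    · rw [Fin.append_right, ← requ_of_nonneg hC]
      simp [-Fin.natAdd_eq_addNat, Matrix.mulVec, dotProduct]
  simp only [localized, realize]
  rw [e1, e2, e3, realize_twoBlocks hN hC j (by positivity) (by positivity), ← pow_mul, ← pow_mul,
    ← pow_succ', mul_pow C (1 + bump w a x)]
  ring

/-- Networks of depth `j + 4` with about `N ^ 2` weights bounded by `C` realize functions of height
`δ` supported in a ball of radius `w`, as long as `δ` is at most of the order
`N ^ (2 ^ (j + 1) - 1) * C ^ (2 ^ (j + 2) - 1) * w ^ 4`. -/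
theorem exists_localized {d N : ℕ} (hd : 0 < d) (hN' : 0 < N) {M : ℕ} (hM : 1 ≤ M) (j : ℕ)
    {w δ : ℝ} (hw : 0 < w) (hw1 : w ≤ 1) (hδ0 : 0 ≤ δ)
    (hδ : δ ≤ (N : ℝ) ^ (2 ^ (j + 1) - 1) * (M : ℝ) ^ (2 ^ (j + 2) - 1) * w ^ 4)
    {a : Fin d → ℝ} (ha : a ∈ Cube d) :
    ∃ Φ : Network d 1, Φ.numWeights ≤ (2 * d ^ 2 + 4 * d + 8 + 6 * j) * N ^ 2 ∧
      Φ.numLayers = j + 4 ∧ Φ.maxWeight ≤ M ∧ (∀ x, |Φ.realize requ x 0| ≤ δ) ∧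
      Φ.realize requ a 0 = δ ∧ ∀ x i, w ≤ |x i - a i| → Φ.realize requ x 0 = 0 := by
  have hM0 : (0 : ℝ) ≤ M := by positivity
  have hM1 : (1 : ℝ) ≤ M := by exact_mod_cast hM
  have hMp : (0 : ℝ) < M := by linarith
  have hNp : (0 : ℝ) < N := by exact_mod_cast hN'
  have hN : 0 < N + N := by omega
  set G : ℝ := (N * M) ^ (2 ^ (j + 1) - 1) * (M : ℝ) ^ 2 ^ (j + 1) with hG
  set H : ℝ := (1 + w ^ 4) ^ 2 ^ (j + 1) - 1 with hH
  -- Bernoulli's inequality, where w^4 is the peak of the bump.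
  have hwH : w ^ 4 ≤ H := by
    have := one_add_mul_le_pow (a := w ^ 4) (by linarith [pow_pos hw 4]) (2 ^ (j + 1))
    have h1 : (1 : ℝ) ≤ ((2 ^ (j + 1) : ℕ) : ℝ) := by exact_mod_cast Nat.one_le_two_pow
    nlinarith [pow_pos hw 4]
  have hHp : 0 < H := (pow_pos hw 4).trans_le hwH
  have hGp : 0 < G := by positivity
  have hGe : G = (N : ℝ) ^ (2 ^ (j + 1) - 1) * (M : ℝ) ^ (2 ^ (j + 2) - 1) := by
    have e : 2 ^ (j + 2) - 1 = (2 ^ (j + 1) - 1) + 2 ^ (j + 1) := by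
      have := Nat.one_le_two_pow (n := j + 1)
      rw [pow_succ 2 (j + 1)]; omega
    rw [hG, e, pow_add, mul_pow]; ring
  have hδG : δ ≤ G * H := by
    rw [← hGe] at hδ
    exact hδ.trans (mul_le_mul_of_nonneg_left hwH hGp.le)
  have hs0 : 0 ≤ δ / (G * H) := by positivity
  have hs1 : δ / (G * H) ≤ 1 := (div_le_one (by positivity)).2 hδG
  -- The peak at full output weight is G * H; the output scale δ / (G * H) ≤ 1 makes it exactly δ.
  refine ⟨localized hd hN M (δ / (G * H)) w a j, numWeights_localized_le hd hN,
    numLayers_localized hd hN, maxWeight_localized_le hd hN (by exact_mod_cast hM)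
      (by simp) (by rwa [abs_of_nonneg hs0]) (by rwa [abs_of_pos hw]) ha, fun x => ?_, ?_,
    fun x i hx => ?_⟩
  · have hb0 : 0 ≤ bump w a x := requ_nonneg _
    have hb1 := bump_le w a x
    have hx0 : 0 ≤ (1 + bump w a x) ^ 2 ^ (j + 1) - 1 :=
      sub_nonneg.2 (one_le_pow₀ (by linarith))
    have hx1 : (1 + bump w a x) ^ 2 ^ (j + 1) - 1 ≤ H :=
      sub_le_sub_right (pow_le_pow_left₀ (by linarith) (by linarith) _) _
    rw [realize_localized hd hN hM0, ← hG, abs_of_nonneg (by positivity)]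
    calc _ ≤ δ / (G * H) * G * H := by gcongr
      _ = δ := by field_simp
  · rw [realize_localized hd hN hM0, ← hG, bump_self, ← hH]
    field_simp
  · rw [realize_localized hd hN hM0, bump_eq_zero hw.le hx]
    simp

end Network

/-! ### Membership in the unit ball -/

theorem zero_mem_networkClass {d : ℕ} (hd : 0 < d) {ℓ c : ℕ+ → ℕ∞} {n : ℕ+} (hℓ : 1 ≤ ℓ n) :
    (fun _ => 0 : (Fin d → ℝ) → ℝ) ∈ networkClass d ℓ c n := by
  refine ⟨.last hd one_pos 0 0, ?_, ?_, ?_, ?_⟩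
  · simp [Network.numWeights, numNonzero, hammingNorm]
  · simpa [Network.numLayers] using hℓ
  · have : (Network.last hd one_pos (0 : Matrix (Fin 1) (Fin d) ℝ) 0).maxWeight ≤ 0 :=
      maxEntry_le_iff.2 (by simp)
    rw [nonpos_iff_eq_zero.1 this]
    simp
  · funext x
    simp [Network.realize]

theorem networkClass_mono {d : ℕ} {ℓ c : ℕ+ → ℕ∞} (hℓ : Monotone ℓ) (hc : Monotone c) :
    Monotone (networkClass d ℓ c) := by
  rintro n n' h _ ⟨Φ, h1, h2, h3, rfl⟩
  exact ⟨Φ, h1.trans (by exact_mod_cast h), h2.trans (hℓ h),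
    h3.trans (ENat.toENNReal_le.2 (hc h)), rfl⟩

/-- For k ≥ n the function itself lies in the k-th class; for k ≤ n the zero network already has
error at most n^(-α) ≤ k^(-α). -/
theorem mem_unitBall_of_mem_networkClass {d : ℕ} (hd : 0 < d) {ℓ c : ℕ+ → ℕ∞} (hℓ : Monotone ℓ)
    (hc : Monotone c) (hℓ1 : ∀ n, 1 ≤ ℓ n) {α : ℝ} (hα : 0 ≤ α) {n : ℕ+} {g : (Fin d → ℝ) → ℝ}
    (hg : g ∈ networkClass d ℓ c n) {v : C(Cube d, ℝ)} (hv : ∀ x : Cube d, v x = g x)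
    (hle : ∀ x, |v x| ≤ ((n : ℕ) : ℝ) ^ (-α)) : v ∈ unitBall d ℓ c α := by
  have hn : (1 : ℝ) ≤ ((n : ℕ) : ℝ) := by exact_mod_cast n.pos
  have hnorm : eLpNorm v ∞ (cubeVolume d) ≤ ENNReal.ofReal (((n : ℕ) : ℝ) ^ (-α)) := by
    rw [eLpNorm_exponent_top]
    exact eLpNormEssSup_le_of_ae_bound (Filter.Eventually.of_forall hle)
  refine ⟨memLp_top_of_bound v.continuous.aestronglyMeasurable _
    (Filter.Eventually.of_forall hle), ?_⟩
  refine sInf_le ⟨1, one_pos, ?_, by simp⟩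
  simp only [div_one]
  refine max_le (hnorm.trans ?_) (iSup_le fun k => ?_)
  · rw [← ENNReal.ofReal_one]
    exact ENNReal.ofReal_le_ofReal (Real.rpow_le_one_of_one_le_of_nonpos hn (by linarith))
  · rcases le_total n k with h | h
    · have h0 : lpDist ∞ v (networkClass d ℓ c k) ≤ 0 := by
        refine iInf₂_le_of_le g (networkClass_mono hℓ hc h hg) ?_
        have e : (fun x : Cube d => v x - g x) = 0 := funext fun x => by simp [hv]
        simp [e]
      rw [nonpos_iff_eq_zero.1 h0]
      simp
    · have hk : (0 : ℝ) < ((k : ℕ) : ℝ) := by exact_mod_cast k.pos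
      have hkn : ((k : ℕ) : ℝ) ≤ ((n : ℕ) : ℝ) := by exact_mod_cast h
      have h0 : lpDist ∞ v (networkClass d ℓ c k) ≤ ENNReal.ofReal (((n : ℕ) : ℝ) ^ (-α)) := by
        refine iInf₂_le_of_le _ (zero_mem_networkClass hd (hℓ1 k)) ?_
        simpa using hnorm
      calc _ ≤ ENNReal.ofReal (((k : ℕ) : ℝ) ^ α) * ENNReal.ofReal (((n : ℕ) : ℝ) ^ (-α)) := by
            gcongr
        _ ≤ 1 := by
            rw [← ENNReal.ofReal_mul (by positivity), ← ENNReal.ofReal_one]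
            refine ENNReal.ofReal_le_ofReal ?_
            rw [Real.rpow_neg (by linarith), ← div_eq_mul_inv]
            exact div_le_one_of_le₀ (Real.rpow_le_rpow hk.le hkn hα) (by positivity)

/-! ### Monte Carlo methods -/

/-- Disjoint supports let N samples see at most N bumps. On an unseen bump the output is the same as
on 0, so the errors at the bump and at 0 add up to at least δ; seen bumps are paid for by the term
δN. Being linear in N, the bound can be integrated against a random sample count. -/
theorem card_mul_le_of_mem_alg {d : ℕ} {U : Set C(Cube d, ℝ)} {ι : Type} [Fintype ι]
    {f : ι → C(Cube d, ℝ)} (hf : ∀ k, f k ∈ U) (h0 : (0 : C(Cube d, ℝ)) ∈ U) {z : ι → Cube d}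
    {δ : ℝ} (hδ : ∀ k, f k (z k) = δ) (hdisj : ∀ y k k', f k y ≠ 0 → f k' y ≠ 0 → k = k')
    {N : ℕ+} {A : U → C(Cube d, ℝ)} (hA : A ∈ Alg N U C(Cube d, ℝ)) :
    (Fintype.card ι : ℝ≥0∞) * ENNReal.ofReal δ ≤
      ∑ k, (‖iotaInf U ⟨f k, hf k⟩ - A ⟨f k, hf k⟩‖ₑ + ‖iotaInf U ⟨0, h0⟩ - A ⟨0, h0⟩‖ₑ) +
        ENNReal.ofReal δ * (N : ℕ) := by
  classical
  obtain ⟨x, Q, hQ⟩ := hA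
  let S : Finset ι := Finset.univ.filter fun k => ∃ i, f k (x i) ≠ 0
  have hS : S.card ≤ N := by
    have hex : ∀ k : S, ∃ i, f k (x i) ≠ 0 := fun k => (Finset.mem_filter.1 k.2).2
    choose e he using hex
    have hinj : Function.Injective e := fun k k' h => Subtype.ext
      (hdisj (x (e k)) k k' (he k) (by rw [h]; exact he k'))
    simpa using Fintype.card_le_of_injective e hinj
  have hpt : ∀ k, ENNReal.ofReal δ ≤
      (‖iotaInf U ⟨f k, hf k⟩ - A ⟨f k, hf k⟩‖ₑ + ‖iotaInf U ⟨0, h0⟩ - A ⟨0, h0⟩‖ₑ) +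
        if k ∈ S then ENNReal.ofReal δ else 0 := by
    intro k
    split_ifs with hk
    · exact le_add_self
    · have hz : ∀ i, f k (x i) = 0 := fun i => by
        by_contra h
        exact hk (Finset.mem_filter.2 ⟨Finset.mem_univ _, i, h⟩)
      have e : A ⟨f k, hf k⟩ = A ⟨0, h0⟩ := by
        rw [hQ, hQ]
        congr 1
        funext i
        simpa using hz i
      rw [e, add_zero]
      have h1 : ENNReal.ofReal δ ≤ ‖f k‖ₑ := by
        rw [← ofReal_norm, ← hδ k]
        exact ENNReal.ofReal_le_ofReal ((le_abs_self _).trans ((f k).norm_coe_le_norm (z k)))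
      refine h1.trans ?_
      have h2 : f k = (iotaInf U ⟨f k, hf k⟩ - A ⟨0, h0⟩) - (iotaInf U ⟨0, h0⟩ - A ⟨0, h0⟩) := by
        simp [iotaInf]
      conv_lhs => rw [h2]
      exact enorm_sub_le
  calc (Fintype.card ι : ℝ≥0∞) * ENNReal.ofReal δ = ∑ _k : ι, ENNReal.ofReal δ := by simp
    _ ≤ _ := Finset.sum_le_sum fun k _ => hpt k
    _ ≤ _ := by
        rw [Finset.sum_add_distrib]
        gcongr
        rw [Finset.sum_ite_mem, Finset.univ_inter, Finset.sum_const, nsmul_eq_mul, mul_comm]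
        gcongr

theorem le_mcError {d : ℕ} {U : Set C(Cube d, ℝ)} {ι : Type} [Fintype ι] {m : ℕ+}
    (hcard : 4 * (m : ℕ) ≤ Fintype.card ι)
    {f : ι → C(Cube d, ℝ)} (hf : ∀ k, f k ∈ U) (h0 : (0 : C(Cube d, ℝ)) ∈ U) {z : ι → Cube d}
    {δ : ℝ} (hδ0 : 0 < δ) (hδ : ∀ k, f k (z k) = δ)
    (hdisj : ∀ y k k', f k y ≠ 0 → f k' y ≠ 0 → k = k') :
    ENNReal.ofReal (δ / 4) ≤ mcError.{u} m U (iotaInf U) := by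
  refine le_sInf ?_
  rintro _ ⟨Ω, _, P, A, N, hP, hMC, rfl⟩
  set E := ⨆ v : U, ∫⁻ ω, ‖iotaInf U v - A ω v‖ₑ ∂P with hE
  have hmeas : ∀ v : U, Measurable fun ω => ‖iotaInf U v - A ω v‖ₑ := fun v => by
    let _ : MeasurableSpace C(Cube d, ℝ) := borel _
    have : BorelSpace C(Cube d, ℝ) := ⟨rfl⟩
    have hc : Continuous fun y : C(Cube d, ℝ) => ‖iotaInf U v - y‖ₑ := by fun_prop
    exact hc.measurable.comp (hMC.measurable_method v)
  have hEv : ∀ v : U, ∫⁻ ω, ‖iotaInf U v - A ω v‖ₑ ∂P ≤ E := fun v =>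
    le_iSup (fun v : U => ∫⁻ ω, ‖iotaInf U v - A ω v‖ₑ ∂P) v
  have key : (Fintype.card ι : ℝ≥0∞) * ENNReal.ofReal δ ≤
      (Fintype.card ι : ℝ≥0∞) * (E + E) + ENNReal.ofReal δ * (m : ℕ) := by
    calc (Fintype.card ι : ℝ≥0∞) * ENNReal.ofReal δ
        = ∫⁻ _ω, (Fintype.card ι : ℝ≥0∞) * ENNReal.ofReal δ ∂P := by simp
      _ ≤ ∫⁻ ω, (∑ k, (‖iotaInf U ⟨f k, hf k⟩ - A ω ⟨f k, hf k⟩‖ₑ +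
            ‖iotaInf U ⟨0, h0⟩ - A ω ⟨0, h0⟩‖ₑ) + ENNReal.ofReal δ * (N ω : ℕ)) ∂P :=
          lintegral_mono fun ω => card_mul_le_of_mem_alg hf h0 hδ hdisj (hMC.mem_alg ω)
      _ = ∑ k, (∫⁻ ω, ‖iotaInf U ⟨f k, hf k⟩ - A ω ⟨f k, hf k⟩‖ₑ ∂P +
            ∫⁻ ω, ‖iotaInf U ⟨0, h0⟩ - A ω ⟨0, h0⟩‖ₑ ∂P) +
            ENNReal.ofReal δ * ∫⁻ ω, ((N ω : ℕ) : ℝ≥0∞) ∂P := by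
          have hm2 : ∀ k, Measurable fun ω => ‖iotaInf U ⟨f k, hf k⟩ - A ω ⟨f k, hf k⟩‖ₑ +
              ‖iotaInf U ⟨0, h0⟩ - A ω ⟨0, h0⟩‖ₑ := fun k => (hmeas _).add (hmeas _)
          rw [lintegral_add_left (Finset.measurable_fun_sum _ fun k _ => hm2 k),
            lintegral_finsetSum _ fun k _ => hm2 k, lintegral_const_mul' _ _ ENNReal.ofReal_ne_top]
          congr 1
          exact Finset.sum_congr rfl fun k _ => lintegral_add_left (hmeas _) _
      _ ≤ ∑ _k : ι, (E + E) + ENNReal.ofReal δ * (m : ℕ) := by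
          gcongr
          · exact hEv _
          · exact hEv _
          · exact hMC.mean_count
      _ = _ := by simp [mul_add]
  -- If E < δ/4, the averaged inequality gives card/2 ≤ m, against card ≥ 4m.
  by_contra! hlt
  have hm : (0 : ℝ) < ((m : ℕ) : ℝ) := by exact_mod_cast m.pos
  have hcard' : 4 * ((m : ℕ) : ℝ) ≤ Fintype.card ι := by exact_mod_cast hcard
  have hle : (Fintype.card ι : ℝ≥0∞) * ENNReal.ofReal δ ≤ ENNReal.ofReal
      (Fintype.card ι * (δ / 4 + δ / 4) + δ * (m : ℕ)) := by
    refine key.trans ?_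
    rw [ENNReal.ofReal_add (by positivity) (by positivity), ENNReal.ofReal_mul (by positivity),
      ENNReal.ofReal_mul hδ0.le, ENNReal.ofReal_add (by positivity) (by positivity),
      ENNReal.ofReal_natCast, ENNReal.ofReal_natCast]
    gcongr
  rw [← ENNReal.ofReal_natCast, ← ENNReal.ofReal_mul (by positivity),
    ENNReal.ofReal_le_ofReal_iff (by positivity)] at hle
  nlinarith

/-! ### The lower error bound -/

theorem mul_rpow_le_pow_mul_pow {a b : ℕ} {x N C K₁ K₂ p₁ p₂ q : ℝ} (hx : 1 ≤ x) (h₁ : 0 < K₁)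
    (h₂ : 0 < K₂) (hN : K₁ * x ^ p₁ ≤ N) (hC : K₂ * x ^ p₂ ≤ C) (hq : q ≤ p₁ * a + p₂ * b) :
    K₁ ^ a * K₂ ^ b * x ^ q ≤ N ^ a * C ^ b := by
  have hx0 : 0 < x := by linarith
  have hN0 : 0 ≤ N := le_trans (by positivity) hN
  calc K₁ ^ a * K₂ ^ b * x ^ q ≤ K₁ ^ a * K₂ ^ b * x ^ (p₁ * a + p₂ * b) := by gcongr
    _ = (K₁ * x ^ p₁) ^ a * (K₂ * x ^ p₂) ^ b := by
        rw [Real.rpow_add hx0, Real.rpow_mul hx0.le, Real.rpow_natCast, Real.rpow_mul hx0.le,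
          Real.rpow_natCast]
        ring
    _ ≤ _ := by gcongr

/-- Networks of depth `j + 5` have enough amplification to produce many disjoint bumps. -/
theorem eventually_height_le {α θ κ : ℝ} (hα : 0 < α) (hθ : 0 ≤ θ) {C : ℕ+ → ℕ} {a : ℝ}
    (ha : 0 < a) (hC : ∀ n : ℕ+,
      a * (((n : ℕ) : ℝ) ^ θ * Real.log (2 * ((n : ℕ) : ℝ)) ^ κ) ≤ C n)
    (j : ℕ) {W : ℕ} (hW : 0 < W) {γ : ℝ} (hγ : γ = ((2 : ℝ) ^ (j + 5) - 1) * (θ + 1 / 2)) :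
    ∀ᶠ N : ℕ in Filter.atTop, ∀ n : ℕ+, (n : ℕ) = W * N ^ 2 → ∀ P : ℝ, 0 < P →
      P ≤ ((n : ℕ) : ℝ) ^ ((8 * α + γ) / 64) →
      ((n : ℕ) : ℝ) ^ (-α) ≤
        (N : ℝ) ^ (2 ^ (j + 2) - 1) * (C n : ℝ) ^ (2 ^ (j + 3) - 1) * (1 / (8 * P)) ^ 4 := by
  set X : ℝ := 2 ^ (j + 2) with hX
  have hX4 : 4 ≤ X := by
    have : (1 : ℝ) ≤ 2 ^ j := one_le_pow₀ (by norm_num)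
    rw [hX, pow_add]; linarith
  have hX5 : (2 : ℝ) ^ (j + 5) = 8 * X := by rw [hX]; ring
  have e1 : ((2 ^ (j + 2) - 1 : ℕ) : ℝ) = X - 1 := by
    rw [Nat.cast_sub Nat.one_le_two_pow]; simp [hX]
  have e2 : ((2 ^ (j + 3) - 1 : ℕ) : ℝ) = 2 * X - 1 := by
    rw [Nat.cast_sub Nat.one_le_two_pow, hX]; push_cast; ring
  have hXp : 0 < 2 * X - 1 := by linarith
  -- With this ε the logarithms cost only a factor n^(1/4).
  obtain ⟨K, hK, hKC⟩ := mul_rpow_le_of_growth ha (ε := 1 / (4 * (2 * X - 1))) (by positivity) hC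
  have hWp : (0 : ℝ) < W := by exact_mod_cast hW
  set K₁ : ℝ := (W : ℝ) ^ (-(1 / 2) : ℝ) with hK₁
  have hK₁p : 0 < K₁ := by positivity
  set D : ℝ := K₁ ^ (2 ^ (j + 2) - 1) * K ^ (2 ^ (j + 3) - 1) with hD
  have hDp : 0 < D := by positivity
  have htend : Filter.Tendsto (fun N : ℕ => ((N : ℝ)) ^ (1 / 4 : ℝ)) Filter.atTop Filter.atTop :=
    (tendsto_rpow_atTop (by norm_num)).comp tendsto_natCast_atTop_atTop
  -- For large N a spare factor n^(1/4) pays for the constant D and for the 8^4 coming from w =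
  -- 1/(8P).
  filter_upwards [htend.eventually_ge_atTop (8 ^ 4 / D)] with N hN n hn P hP hPn
  have hn1 : (1 : ℝ) ≤ ((n : ℕ) : ℝ) := by exact_mod_cast n.pos
  have hn0 : (0 : ℝ) < ((n : ℕ) : ℝ) := by linarith
  have hN0 : 0 < N := by
    rcases Nat.eq_zero_or_pos N with h | h
    · have := n.pos
      simp [h] at hn
    · exact h
  have hNp : (0 : ℝ) < N := by exact_mod_cast hN0
  have hNn : K₁ * ((n : ℕ) : ℝ) ^ (1 / 2 : ℝ) ≤ N := by
    rw [hn]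
    push_cast
    rw [Real.mul_rpow hWp.le (by positivity), ← mul_assoc, hK₁, ← Real.rpow_add hWp,
      ← Real.rpow_natCast, ← Real.rpow_mul hNp.le]
    norm_num
  have hNle : (N : ℝ) ≤ ((n : ℕ) : ℝ) := by
    have : N ≤ (n : ℕ) := by rw [hn]; nlinarith [Nat.mul_le_mul hW (Nat.le_self_pow two_ne_zero N)]
    exact_mod_cast this
  have hbig : 8 ^ 4 ≤ D * ((n : ℕ) : ℝ) ^ (1 / 4 : ℝ) := by
    rw [div_le_iff₀' hDp] at hN
    exact hN.trans (by gcongr)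
  -- With N ≈ n^(1/2) the available exponent is (X-1)/2 + (2X-1)θ - 1/4. It exceeds γ/16 + 1/4
  -- because X ≥ 4, that is, because the depth is at least 5.
  have hgain := mul_rpow_le_pow_mul_pow (a := 2 ^ (j + 2) - 1) (b := 2 ^ (j + 3) - 1)
    (q := γ / 16 + 1 / 4) hn1 hK₁p hK hNn (hKC n) (by
      rw [e1, e2, sub_mul]
      have : 1 / (4 * (2 * X - 1)) * (2 * X - 1) = 1 / 4 := by field_simp
      rw [this, hγ, hX5]
      nlinarith)
  have hγ0 : 0 ≤ γ := by
    rw [hγ, hX5]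
    exact mul_nonneg (by linarith) (by linarith)
  have hP4 : P ^ 4 ≤ ((n : ℕ) : ℝ) ^ (α / 2 + γ / 16) := by
    calc P ^ 4 ≤ (((n : ℕ) : ℝ) ^ ((8 * α + γ) / 64)) ^ 4 := by gcongr
      _ = _ := by
        rw [← Real.rpow_natCast, ← Real.rpow_mul hn0.le]
        congr 1
        push_cast; ring
  have hprod : (8 * P) ^ 4 * ((n : ℕ) : ℝ) ^ (-α) ≤
      (N : ℝ) ^ (2 ^ (j + 2) - 1) * (C n : ℝ) ^ (2 ^ (j + 3) - 1) := by
    calc (8 * P) ^ 4 * ((n : ℕ) : ℝ) ^ (-α)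
        = 8 ^ 4 * (P ^ 4 * ((n : ℕ) : ℝ) ^ (-α)) := by ring
      _ ≤ D * ((n : ℕ) : ℝ) ^ (1 / 4 : ℝ) *
            (((n : ℕ) : ℝ) ^ (α / 2 + γ / 16) * ((n : ℕ) : ℝ) ^ (-α)) := by gcongr
      _ = D * ((n : ℕ) : ℝ) ^ (1 / 4 + (α / 2 + γ / 16 + -α)) := by
          rw [Real.rpow_add hn0 (1 / 4), Real.rpow_add hn0 (α / 2 + γ / 16)]; ring
      _ ≤ D * ((n : ℕ) : ℝ) ^ (γ / 16 + 1 / 4) := by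
          refine mul_le_mul_of_nonneg_left ?_ hDp.le
          exact Real.rpow_le_rpow_of_exponent_le hn1 (by linarith)
      _ ≤ _ := hgain
  rw [one_div, inv_pow, ← div_eq_mul_inv, le_div_iff₀' (by positivity)]
  exact hprod

/-- The fooling family consists of bumps at (4P)^d ≥ 4m grid points. Their radius w is half the grid
spacing 1/(4P), which makes the supports disjoint. -/
theorem le_mcError_unitBall {d : ℕ} (hd : 0 < d) {ℓ c : ℕ+ → ℕ∞} (hℓ : Monotone ℓ)
    (hc : Monotone c) (hℓ1 : ∀ n, 1 ≤ ℓ n) {α : ℝ} (hα : 0 ≤ α) {j N M : ℕ} {n P m : ℕ+}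
    (hℓn : ((j + 4 : ℕ) : ℕ∞) ≤ ℓ n) (hcn : c n = M) (hM : 1 ≤ M)
    (hn : (n : ℕ) = (2 * d ^ 2 + 4 * d + 8 + 6 * j) * N ^ 2) (hm : (m : ℕ) = P ^ d)
    (hP : ((n : ℕ) : ℝ) ^ (-α) ≤
      (N : ℝ) ^ (2 ^ (j + 1) - 1) * (M : ℝ) ^ (2 ^ (j + 2) - 1) * (1 / (8 * (P : ℕ))) ^ 4) :
    ENNReal.ofReal (((n : ℕ) : ℝ) ^ (-α) / 4) ≤
      mcError.{u} m (unitBall d ℓ c α) (iotaInf (unitBall d ℓ c α)) := by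
  have hN0 : 0 < N := by
    rcases Nat.eq_zero_or_pos N with h | h
    · have := n.pos
      simp [h] at hn
    · exact h
  have hn1 : (1 : ℝ) ≤ ((n : ℕ) : ℝ) := by exact_mod_cast n.pos
  have hP1 : (1 : ℝ) ≤ ((P : ℕ) : ℝ) := by exact_mod_cast P.pos
  set w : ℝ := 1 / (8 * (P : ℕ)) with hw
  have hw0 : 0 < w := by positivity
  have hw1 : w ≤ 1 := by
    rw [hw, div_le_one (by positivity)]; linarith
  set a : (Fin d → Fin (4 * P)) → Cube d := fun k =>
    ⟨fun i => (k i : ℕ) / (4 * (P : ℕ) : ℝ), fun i => by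
      simp only [Pi.zero_apply]; positivity, fun i => by
      simp only [Pi.one_apply]
      rw [div_le_one (by positivity)]
      exact_mod_cast (k i).2.le⟩ with hadef
  choose Φ hΦW hΦL hΦM hΦle hΦa hΦ0 using fun k => Network.exists_localized hd hN0 hM j hw0 hw1
    (by positivity) hP (a k).2
  have hclass : ∀ k, (fun x => (Φ k).realize requ x 0) ∈ networkClass d ℓ c n := fun k => by
    refine ⟨Φ k, hn ▸ hΦW k, by rw [hΦL k]; exact hℓn, ?_, rfl⟩
    rw [hcn, ENat.toENNReal_coe, ← ENNReal.coe_natCast, ENNReal.coe_le_coe]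
    exact hΦM k
  let f : (Fin d → Fin (4 * P)) → C(Cube d, ℝ) := fun k =>
    ⟨fun x => (Φ k).realize requ x 0,
      (continuous_apply 0).comp ((Φ k).continuous_realize.comp continuous_subtype_val)⟩
  have hfU : ∀ k, f k ∈ unitBall d ℓ c α := fun k =>
    mem_unitBall_of_mem_networkClass hd hℓ hc hℓ1 hα (hclass k) (fun x => rfl) fun x => hΦle k x
  have h0U : (0 : C(Cube d, ℝ)) ∈ unitBall d ℓ c α :=
    mem_unitBall_of_mem_networkClass hd hℓ hc hℓ1 hα (zero_mem_networkClass hd (hℓ1 n))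
      (fun x => rfl) fun x => by simp; positivity
  refine le_mcError (ι := Fin d → Fin (4 * P)) ?_ hfU h0U (z := a) (by positivity)
    (fun k => hΦa k) fun y k k' hk hk' => ?_
  · rw [hm]
    simp only [Fintype.card_pi, Fintype.card_fin, Finset.prod_const, Finset.card_univ, mul_pow]
    exact Nat.mul_le_mul_right _ (Nat.le_self_pow hd.ne' 4)
  · funext i
    have h1 : |(y : Fin d → ℝ) i - (k i : ℕ) / (4 * (P : ℕ) : ℝ)| < w := by
      by_contra! h
      exact hk (hΦ0 k y i h)
    have h2 : |(y : Fin d → ℝ) i - (k' i : ℕ) / (4 * (P : ℕ) : ℝ)| < w := by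
      by_contra! h
      exact hk' (hΦ0 k' y i h)
    have h3 : |((k i : ℕ) : ℝ) / (4 * (P : ℕ) : ℝ) - (k' i : ℕ) / (4 * (P : ℕ) : ℝ)| < 2 * w := by
      rw [abs_lt] at *
      constructor <;> linarith
    have h4 : 2 * w = 1 / (4 * (P : ℕ) : ℝ) := by rw [hw]; field_simp; norm_num
    rw [h4, ← sub_div, abs_div, abs_of_pos (by positivity : (0 : ℝ) < 4 * (P : ℕ)),
      div_lt_div_iff_of_pos_right (by positivity)] at h3
    have h5 : |((k i : ℕ) : ℤ) - (k' i : ℕ)| < 1 := by exact_mod_cast h3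
    have h6 := Int.abs_lt_one_iff.1 h5
    exact Fin.ext (by omega)

/-- If the errors are bounded below along the sample sizes `⌊n ^ μ⌋ ^ d` with `n = W * N ^ 2`, then
the optimal order is at most `α / (μ * d)`. -/
theorem optimalOrder_le {d : ℕ} (hd : 0 < d) {α μ : ℝ} (hμ : 0 < μ) {W : ℕ}
    (hW : 0 < W) {e : ℕ+ → ℝ≥0∞}
    (h : ∀ᶠ N : ℕ in Filter.atTop, ∀ n P m : ℕ+, (n : ℕ) = W * N ^ 2 →
      ((P : ℕ) : ℝ) ≤ ((n : ℕ) : ℝ) ^ μ → (m : ℕ) = P ^ d →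
      ENNReal.ofReal (((n : ℕ) : ℝ) ^ (-α) / 4) ≤ e m) :
    optimalOrder e ≤ ENNReal.ofReal (α / (μ * d)) := by
  refine sSup_le ?_
  rintro _ ⟨β, hβ, rfl, C, hC, hle⟩
  refine ENNReal.ofReal_le_ofReal ?_
  have hd' : (0 : ℝ) < d := by exact_mod_cast hd
  rw [le_div_iff₀ (by positivity)]
  by_contra! hlt
  -- A rate β above α/(μd) would keep n^η bounded along n = W N^2.
  set η := β * (μ * d) - α with hη
  have hη0 : 0 < η := by linarith
  have htend : Filter.Tendsto (fun N : ℕ => ((N : ℝ)) ^ η) Filter.atTop Filter.atTop :=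
    (tendsto_rpow_atTop hη0).comp tendsto_natCast_atTop_atTop
  obtain ⟨N, hN, hNbig, hN1⟩ := (h.and ((htend.eventually_gt_atTop
    (4 * (C * 2 ^ (d * β)))).and (Filter.eventually_ge_atTop 1))).exists
  have hn0 : 0 < W * N ^ 2 := by positivity
  let n : ℕ+ := ⟨W * N ^ 2, hn0⟩
  have hn1 : (1 : ℝ) ≤ ((n : ℕ) : ℝ) := by exact_mod_cast n.pos
  have hnp : (0 : ℝ) < ((n : ℕ) : ℝ) := by linarith
  obtain ⟨P, hP0, hPn, hnP⟩ := exists_nat_near (Real.one_le_rpow hn1 hμ.le)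
  have hPp : (0 : ℝ) < P := by exact_mod_cast hP0
  have key := (hN n ⟨P, hP0⟩ ⟨P ^ d, by positivity⟩ rfl hPn rfl).trans (hle _)
  rw [ENNReal.ofReal_le_ofReal_iff (by simp only [PNat.mk_coe]; positivity)] at key
  simp only [PNat.mk_coe] at key
  have hPb : ((P ^ d : ℕ) : ℝ) ^ (-β) ≤ 2 ^ (d * β) * ((n : ℕ) : ℝ) ^ (-(β * (μ * d))) := by
    calc ((P ^ d : ℕ) : ℝ) ^ (-β) = (P : ℝ) ^ (-(d * β)) := by
          push_cast
          rw [← Real.rpow_natCast, ← Real.rpow_mul hPp.le]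
          ring_nf
      _ = 2 ^ (d * β) * (2 * P : ℝ) ^ (-(d * β)) := by
          rw [Real.mul_rpow (by norm_num) hPp.le, ← mul_assoc, ← Real.rpow_add (by norm_num)]
          simp
      _ ≤ 2 ^ (d * β) * (((n : ℕ) : ℝ) ^ μ) ^ (-(d * β)) := by
          refine mul_le_mul_of_nonneg_left ?_ (by positivity)
          exact Real.rpow_le_rpow_of_nonpos (by positivity) hnP
            (neg_nonpos.2 (by positivity))
      _ = _ := by
          rw [← Real.rpow_mul hnp.le]
          ring_nf
  have h1 : ((n : ℕ) : ℝ) ^ (-α) ≤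
      4 * (C * 2 ^ (d * β)) * ((n : ℕ) : ℝ) ^ (-(β * (μ * d))) := by
    have := mul_le_mul_of_nonneg_left hPb hC.le
    linarith
  have h2 : ((n : ℕ) : ℝ) ^ η ≤ 4 * (C * 2 ^ (d * β)) := by
    have e : η = -α - -(β * (μ * d)) := by rw [hη]; ring
    rw [e, Real.rpow_sub hnp, div_le_iff₀ (by positivity)]
    exact h1
  have h3 : (N : ℝ) ^ η ≤ ((n : ℕ) : ℝ) ^ η := by
    refine Real.rpow_le_rpow (by positivity) ?_ hη0.le
    have : N ≤ W * N ^ 2 := by nlinarith [Nat.mul_le_mul hW (Nat.le_self_pow two_ne_zero N)]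
    exact_mod_cast this
  linarith

theorem errMC_unitBall_le {d : ℕ} (hd : 0 < d) {ℓ c : ℕ+ → ℕ∞} (hℓ : Monotone ℓ)
    (hc : Monotone c) (hℓ1 : ∀ n, 1 ≤ ℓ n) {α θ κ γ : ℝ} (hα : 0 < α) (hθ : 0 ≤ θ)
    (hg : HasGrowth c θ κ) {j : ℕ} {n₀ : ℕ+} (hℓj : ((j + 5 : ℕ) : ℕ∞) ≤ ℓ n₀)
    (hγ : γ = ((2 : ℝ) ^ (j + 5) - 1) * (θ + 1 / 2)) :
    errMC.{u} (unitBall d ℓ c α) (iotaInf (unitBall d ℓ c α)) ≤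
      ENNReal.ofReal (64 / (d : ℝ) * (α / (8 * α + γ))) := by
  obtain ⟨C, hcC, hC1, a, b, ha, hb, hab⟩ := hg.exists_nat
  have hγ0 : 0 ≤ γ := by
    have : (1 : ℝ) ≤ 2 ^ (j + 5) := one_le_pow₀ (by norm_num)
    rw [hγ]
    exact mul_nonneg (by linarith) (by linarith)
  have hd' : (0 : ℝ) < d := by exact_mod_cast hd
  have e : 64 / (d : ℝ) * (α / (8 * α + γ)) = α / ((8 * α + γ) / 64 * d) := by
    field_simp
  have hW : 0 < 2 * d ^ 2 + 4 * d + 8 + 6 * (j + 1) := by omega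
  rw [e]
  refine optimalOrder_le hd (by positivity) hW ?_
  filter_upwards [eventually_height_le hα hθ ha (fun n => (hab n).1) j hW hγ,
    Filter.eventually_ge_atTop (n₀ : ℕ)] with N hN hNn n P m hn hP hm
  have hn₀ : n₀ ≤ n := by
    have : N ≤ (n : ℕ) := by rw [hn]; nlinarith [Nat.mul_le_mul hW (Nat.le_self_pow two_ne_zero N)]
    exact_mod_cast hNn.trans this
  have hP0 : (0 : ℝ) < ((P : ℕ) : ℝ) := by exact_mod_cast P.pos
  -- Localized networks enter with parameter j + 1, hence with j + 5 layers, a depth allowed from n₀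
  -- on.
  exact le_mcError_unitBall hd hℓ hc hℓ1 hα.le (hℓj.trans (hℓ hn₀)) (hcC n) (hC1 n) hn hm
    (hN n hn P hP0 hP)

end ReQUApprox

end

/-! ### Both bounds, via deterministic order ≤ Monte Carlo order -/

theorem mainTheorem1 (d : ℕ) (hd : 1 ≤ d) (α : ℝ) (hα : 0 < α) (θ κ : ℝ) (hθ : 0 ≤ θ)
    (ℓ c : ℕ+ → ℕ∞) (hℓ_mono : Monotone ℓ) (hc_mono : Monotone c)
    (hℓ_five : ∀ n, 5 ≤ ℓ n) (hℓ_bdd : ReQUApprox.maxDepth ℓ < ⊤)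
    (hc : ReQUApprox.HasGrowth c θ κ)
    (γ : ℝ) (hγ : γ = ((2 : ℝ) ^ (ReQUApprox.maxDepth ℓ).toNat - 1) * (θ + 1 / 2))
    (U : Set C(ReQUApprox.Cube d, ℝ)) (hU : U = ReQUApprox.unitBall d ℓ c α) :
    (ENNReal.ofReal (1 / (d : ℝ) * (α / (α + γ))) ≤
        ReQUApprox.errDet U (ReQUApprox.iotaInf U) ∧
      ReQUApprox.errDet U (ReQUApprox.iotaInf U) ≤
        ENNReal.ofReal (64 / (d : ℝ) * (α / (8 * α + γ)))) ∧
    (ENNReal.ofReal (1 / (d : ℝ) * (α / (α + γ))) ≤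
        ReQUApprox.errMC.{u} U (ReQUApprox.iotaInf U) ∧
      ReQUApprox.errMC.{u} U (ReQUApprox.iotaInf U) ≤
        ENNReal.ofReal (64 / (d : ℝ) * (α / (8 * α + γ)))) := by
  subst hU
  have hd0 : 0 < d := hd
  -- A finite supremum in ℕ∞ is attained, so the maximal depth is available at some budget.
  obtain ⟨n₀, hn₀⟩ := ENat.exists_eq_iSup_of_lt_top hℓ_bdd
  obtain ⟨j, hj⟩ : ∃ j : ℕ, ReQUApprox.maxDepth ℓ = ((j + 5 : ℕ) : ℕ∞) := by
    have h5 : 5 ≤ (ReQUApprox.maxDepth ℓ).toNat := by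
      have h := (hℓ_five n₀).trans (le_iSup ℓ n₀)
      exact (ENat.toNat_le_toNat h hℓ_bdd.ne)
    refine ⟨(ReQUApprox.maxDepth ℓ).toNat - 5, ?_⟩
    rw [Nat.sub_add_cancel h5, ENat.natCast_toNat hℓ_bdd.ne]
  rw [hj, ENat.toNat_natCast] at hγ
  have hℓ1 : ∀ n, 1 ≤ ℓ n := fun n => le_trans (by norm_num) (hℓ_five n)
  have hle : ∀ n, ℓ n ≤ ((j + 3 + 2 : ℕ) : ℕ∞) := fun n => (le_iSup ℓ n).trans hj.le
  have hγ0 : 0 < γ := by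
    have : (1 : ℝ) < 2 ^ (j + 5) := one_lt_pow₀ (by norm_num) (by omega)
    rw [hγ]
    exact mul_pos (by linarith) (by linarith)
  obtain ⟨K, hK, hLip⟩ := ReQUApprox.exists_lipschitz_networkClass (d := d) hc hle
  rw [← hγ] at hLip
  obtain ⟨C, hC, hdet⟩ := ReQUApprox.exists_detError_le hd hα hγ0 hK
    (U := ReQUApprox.unitBall d ℓ c α)
    fun v hv n x y D hD hxy => ReQUApprox.abs_sub_le_of_mem_unitBall hLip hv n hD hxy
  have hlow : ENNReal.ofReal (1 / (d : ℝ) * (α / (α + γ))) ≤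
      ReQUApprox.errDet (ReQUApprox.unitBall d ℓ c α)
        (ReQUApprox.iotaInf (ReQUApprox.unitBall d ℓ c α)) :=
    le_sSup ⟨_, by positivity, rfl, C, hC, hdet⟩
  have hmono : ReQUApprox.errDet (ReQUApprox.unitBall d ℓ c α)
        (ReQUApprox.iotaInf (ReQUApprox.unitBall d ℓ c α)) ≤
      ReQUApprox.errMC.{u} (ReQUApprox.unitBall d ℓ c α)
        (ReQUApprox.iotaInf (ReQUApprox.unitBall d ℓ c α)) :=
    ReQUApprox.optimalOrder_mono fun m => ReQUApprox.mcError_le_detError m _ _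
  have hup : ReQUApprox.errMC.{u} (ReQUApprox.unitBall d ℓ c α)
        (ReQUApprox.iotaInf (ReQUApprox.unitBall d ℓ c α)) ≤
      ENNReal.ofReal (64 / (d : ℝ) * (α / (8 * α + γ))) :=
    ReQUApprox.errMC_unitBall_le hd0 hℓ_mono hc_mono hℓ1 hα hθ hc (n₀ := n₀)
      (hj.symm.trans hn₀.symm).le hγ
  exact ⟨⟨hlow, hmono.trans hup⟩, hlow.trans hmono, hup⟩
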